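/- All rings are commutative with unit. Let $A$ be a ring, $R$ an $A$-algebra, and $n\geq 1$ an integer. Let $\mathrm{T}^n_AR=R\otimes_A\cdots\otimes_AR$ ($n$ factors), with the action of the symmetric group $\mathfrak{S}_n$ that permutes the factors, and let $$\mathrm{TS}^n_AR=(\mathrm{T}^n_AR)^{\mathfrak{S}_n}\ \subseteq\ \mathrm{TS}^{n-1,1}_AR=(\mathrm{T}^n_AR)^{\mathfrak{S}_{n-1}},$$ where $\mathfrak{S}_{n-1}$ permutes the first $n-1$ factors. The ring $\mathrm{TS}^{n-1,1}_AR$ is an $R$-algebra through the co-projection $\varphi_n:z\mapsto 1\otimes\cdots\otimes 1\otimes z$ on the last factor. For an $n$-tuple $x=(x_1,\dots,x_n)$ of elements of $R$ put $$\alpha(x)=\sum_{\sigma\in\mathfrak{S}_n}(-1)^{|\sigma|}x_{\sigma(1)}\otimes\cdots\otimes x_{\sigma(n)}\in\mathrm{T}^n_AR .$$ Its square $\alpha^2(x)$ lies in $\mathrm{TS}^n_AR$. Let $\mathscr{A}(\alpha^2(x))$ and $\mathscr{R}(\alpha^2(x))$ denote the localizations of $\mathrm{TS}^n_AR$ and of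 $\mathrm{TS}^{n-1,1}_AR$ in the element $\alpha^2(x)$. Define the open subschemes $$\mathscr{U}_R=\bigcup_{x}\operatorname{Spec}\mathscr{A}(\alpha^2(x))\subseteq\operatorname{Spec}(\mathrm{TS}^n_AR),\qquad \mathscr{Z}_R=\bigcup_{x}\operatorname{Spec}\mathscr{R}(\alpha^2(x))\subseteq\operatorname{Spec}(\mathrm{TS}^{n-1,1}_AR),$$ the unions being taken over all $n$-tuples $x$ of elements of $R$. The inclusion $\mathrm{TS}^n_AR\subseteq\mathrm{TS}^{n-1,1}_AR$ induces a morphism $\mathscr{Z}_R\to\mathscr{U}_R$, and $\varphi_n$ induces a morphism $\mathscr{Z}_R\to\operatorname{Spec}R$. "Étale of rank $n$" means finite étale of constant rank $n$. Then: 1. The family $\mathscr{Z}_R\to\mathscr{U}_R$ is étale of rank $n$. 2. The natural morphism $\mathscr{Z}_R\to\operatorname{Spec}(R)\times_{\operatorname{Spec}(A)}\mathscr{U}_R$ is a closed immersion. 3. Let $B$ be an $A$-algebra, and let $E$ be a quotient algebra of $R\otimes_AB$ which is étale of rank $n$ as a $B$-algebra. Then there exists a unique morphism $\mathfrak{n}:\operatorname{Spec}(B)\to\mathscr{U}_R$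 of schemes over $\operatorname{Spec}(A)$ such that $\mathfrak{n}^*\mathscr{Z}_R=\mathscr{Z}_R\times_{\mathscr{U}_R}\operatorname{Spec}(B)$ equals $\operatorname{Spec}(E)$ as closed subschemes of $\operatorname{Spec}(R\otimes_AB)$. -/

import Mathlib

open CategoryTheory CategoryTheory.Limits AlgebraicGeometry
open scoped TensorProduct

universe u

namespace EtaleFamilies

noncomputable section

section Tensors

variable (A R : Type u) [CommRing A] [CommRing R] [Algebra A R] (n : ℕ)

/-- The `n`-fold tensor product `R ⊗ ⋯ ⊗ R` over `A`. -/
abbrev TensorPow : Type u := ⨂[A] _ : Fin n, R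

variable {n}

/-- The algebra endomorphism of the `n`-fold tensor product permuting the factors by `σ`. -/
def permute (σ : Equiv.Perm (Fin n)) : TensorPow A R n →ₐ[A] TensorPow A R n :=
  PiTensorProduct.liftAlgHom
    ((PiTensorProduct.tprod A (s := fun _ : Fin n => R)).domDomCongr σ.symm)
    (by
      rw [MultilinearMap.domDomCongr_apply]
      exact PiTensorProduct.one_def.symm)
    (fun x y => by
      simp only [MultilinearMap.domDomCongr_apply, PiTensorProduct.tprod_mul_tprod]
      rfl)

@[simp]
theorem permute_tprod (σ : Equiv.Perm (Fin n)) (x : Fin n → R) :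
    permute A R σ (PiTensorProduct.tprod A x) =
      PiTensorProduct.tprod A (fun i => x (σ.symm i)) := by
  simp [permute]

/-- The subalgebra of tensors that are invariant under a group `G` of permutations of the
factors. -/
def invariants (G : Subgroup (Equiv.Perm (Fin n))) : Subalgebra A (TensorPow A R n) where
  carrier := {t | ∀ σ ∈ G, permute A R σ t = t}
  mul_mem' ha hb σ hσ := by rw [map_mul, ha σ hσ, hb σ hσ]
  add_mem' ha hb σ hσ := by rw [map_add, ha σ hσ, hb σ hσ]
  algebraMap_mem' r σ _ := AlgHom.commutes _ r

variable (n) in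
/-- The algebra `TSⁿ` of symmetric tensors: the invariants of the full symmetric group. -/
abbrev TS : Subalgebra A (TensorPow A R n) := invariants A R ⊤

/-- The tensors invariant under all permutations that fix the factor `p`. When `p` is the last
factor, this is `TSⁿ⁻¹'¹`, the ring of invariants of the symmetric group on the first
`n - 1` factors. -/
abbrev TSFix (p : Fin n) : Subalgebra A (TensorPow A R n) :=
  invariants A R (MulAction.stabilizer (Equiv.Perm (Fin n)) p)

theorem TS_le_TSFix (p : Fin n) : TS A R n ≤ TSFix A R p :=
  fun _ ht σ _ => ht σ (Subgroup.mem_top σ)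

/-- The inclusion of `TSⁿ` in `TSⁿ⁻¹'¹`. -/
def inclTS (p : Fin n) : TS A R n →ₐ[A] TSFix A R p :=
  Subalgebra.inclusion (TS_le_TSFix A R p)

/-- The co-projection `φ_p` on the factor `p`, as a map into the tensors invariant under the
permutations that fix `p`. -/
def coproj (p : Fin n) : R →ₐ[A] TSFix A R p :=
  (PiTensorProduct.singleAlgHom (R := A) (A := fun _ : Fin n => R) p).codRestrict (TSFix A R p)
    (fun r σ hσ => by
      have hp : σ p = p := hσ
      simp only [PiTensorProduct.singleAlgHom_apply, permute_tprod]
      congr 1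
      funext i
      simp only [MonoidHom.mulSingle_apply, Pi.mulSingle_apply, Equiv.symm_apply_eq, hp])

variable {R}

/-- The alternating tensor `α(x)` of an `n`-tuple `x` of elements. -/
def alternating (x : Fin n → R) : TensorPow A R n :=
  ∑ σ : Equiv.Perm (Fin n),
    (((Equiv.Perm.sign σ : ℤ) : A)) • PiTensorProduct.tprod A (fun i => x (σ i))

theorem permute_alternating (τ : Equiv.Perm (Fin n)) (x : Fin n → R) :
    permute A R τ (alternating A x) = ((Equiv.Perm.sign τ : ℤ) : A) • alternating A x := by
  unfold alternating
  rw [map_sum, Finset.smul_sum]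
  refine Fintype.sum_equiv (Equiv.mulRight τ⁻¹) _ _ (fun σ => ?_)
  rw [map_smul, permute_tprod, smul_smul, Equiv.coe_mulRight, ← Int.cast_mul, ← Units.val_mul,
    Equiv.Perm.sign_mul, Equiv.Perm.sign_inv, mul_left_comm, Int.units_mul_self, mul_one]
  rfl

/-- The symmetric tensor `α²(x)`. -/
def alternatingSq (x : Fin n → R) : TS A R n :=
  ⟨alternating A x ^ 2, fun τ _ => by
    rw [map_pow, permute_alternating, smul_pow, ← Int.cast_pow, ← Units.val_pow_eq_pow_val,
      Int.units_sq, Units.val_one, Int.cast_one, one_smul]⟩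

end Tensors

/-- The index of the last of `n ≥ 1` factors. -/
def lastFactor {n : ℕ} (hn : 1 ≤ n) : Fin n := ⟨n - 1, Nat.sub_lt hn Nat.one_pos⟩

section Schemes

variable (A R : Type u) [CommRing A] [CommRing R] [Algebra A R] (n : ℕ)

/-- The open subscheme `𝒰_R` of `Spec TSⁿ`: the union over all `n`-tuples `x` of the images of
`Spec 𝒜(α²(x))`, where `𝒜(α²(x))` is the localization of `TSⁿ` in `α²(x)`. -/
def U : (Spec (.of (TS A R n))).Opens :=
  ⨆ x : Fin n → R,
    (Spec.map (CommRingCat.ofHom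
      (algebraMap (TS A R n) (Localization.Away (alternatingSq A x))))).opensRange

variable {n}

/-- The scheme `𝒵_R`: the union over all `n`-tuples `x` of the open subschemes `Spec ℛ(α²(x))`
of `Spec TSⁿ⁻¹'¹`, where `ℛ(α²(x))` is the localization of `TSⁿ⁻¹'¹` in `α²(x)`. -/
def Z (p : Fin n) : (Spec (.of (TSFix A R p))).Opens :=
  ⨆ x : Fin n → R,
    (Spec.map (CommRingCat.ofHom
      (algebraMap (TSFix A R p)
        (Localization.Away (inclTS A R p (alternatingSq A x)))))).opensRange

/-- The morphism `Spec TSⁿ⁻¹'¹ ⟶ Spec TSⁿ` given by the inclusion of rings. -/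
def psi (p : Fin n) : Spec (.of (TSFix A R p)) ⟶ Spec (.of (TS A R n)) :=
  Spec.map (CommRingCat.ofHom (inclTS A R p).toRingHom)

variable (n) in
theorem U_eq : U A R n = ⨆ x : Fin n → R, PrimeSpectrum.basicOpen (alternatingSq A x) :=
  iSup_congr fun _ => Scheme.Hom.opensRange_localizationAway (R := .of (TS A R n)) _

theorem Z_eq (p : Fin n) :
    Z A R p = ⨆ x : Fin n → R,
      PrimeSpectrum.basicOpen (inclTS A R p (alternatingSq A x)) :=
  iSup_congr fun _ => Scheme.Hom.opensRange_localizationAway (R := .of (TSFix A R p)) _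

theorem Z_le_preimage (p : Fin n) : Z A R p ≤ psi A R p ⁻¹ᵁ U A R n := by
  intro z hz
  have hz' : z ∈ ⨆ x : Fin n → R,
      PrimeSpectrum.basicOpen (inclTS A R p (alternatingSq A x)) := Z_eq A R p ▸ hz
  obtain ⟨x, hx⟩ := TopologicalSpace.Opens.mem_iSup.1 hz'
  have h : psi A R p z ∈ ⨆ y : Fin n → R, PrimeSpectrum.basicOpen (alternatingSq A y) :=
    TopologicalSpace.Opens.mem_iSup.2 ⟨x, hx⟩
  exact (U_eq A R n).symm ▸ h

/-- The family `𝒵_R ⟶ 𝒰_R`, the restriction of `Spec TSⁿ⁻¹'¹ ⟶ Spec TSⁿ`. On the open piece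
given by `x` it is `Spec ℛ(α²(x)) ⟶ Spec 𝒜(α²(x))`. -/
def family (p : Fin n) : (Z A R p).toScheme ⟶ (U A R n).toScheme :=
  (psi A R p).resLE (U A R n) (Z A R p) (Z_le_preimage A R p)

/-- The structure morphism `𝒰_R ⟶ Spec A`. -/
def UToBase : (U A R n).toScheme ⟶ Spec (.of A) :=
  (U A R n).ι ≫ Spec.map (CommRingCat.ofHom (algebraMap A (TS A R n)))

/-- The morphism `𝒵_R ⟶ Spec R` given by the co-projection `φ_p`. -/
def ZToX (p : Fin n) : (Z A R p).toScheme ⟶ Spec (.of R) :=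
  (Z A R p).ι ≫ Spec.map (CommRingCat.ofHom (coproj A R p).toRingHom)

theorem ZToX_base (p : Fin n) :
    ZToX A R p ≫ Spec.map (CommRingCat.ofHom (algebraMap A R)) =
      family A R p ≫ UToBase A R := by
  have h₁ : (coproj A R p).toRingHom.comp (algebraMap A R) = algebraMap A (TSFix A R p) :=
    (coproj A R p).comp_algebraMap
  have h₂ : (inclTS A R p).toRingHom.comp (algebraMap A (TS A R n)) =
      algebraMap A (TSFix A R p) :=
    (inclTS A R p).comp_algebraMap
  simp only [ZToX, UToBase, family, psi, Category.assoc, Scheme.Hom.resLE_comp_ι_assoc,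
    ← Spec.map_comp, ← CommRingCat.ofHom_comp, h₁, h₂]

/-- The natural morphism `𝒵_R ⟶ Spec R ×_{Spec A} 𝒰_R`. -/
def ZToProd (p : Fin n) :
    (Z A R p).toScheme ⟶
      pullback (Spec.map (CommRingCat.ofHom (algebraMap A R))) (UToBase A R (n := n)) :=
  pullback.lift (ZToX A R p) (family A R p) (ZToX_base A R p)

/-- For a morphism `f : Spec B ⟶ 𝒰_R` over `Spec A`, the natural morphism from the pull-back
`f^* 𝒵_R = 𝒵_R ×_{𝒰_R} Spec B` to `Spec R ×_{Spec A} Spec B = Spec (R ⊗_A B)`. -/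
def pulledBack (p : Fin n) {B : Type u} [CommRing B] [Algebra A B]
    (f : Spec (.of B) ⟶ (U A R n).toScheme)
    (hf : f ≫ UToBase A R = Spec.map (CommRingCat.ofHom (algebraMap A B))) :
    pullback (family A R p) f ⟶ Spec (.of (R ⊗[A] B)) :=
  pullback.lift (pullback.fst (family A R p) f ≫ ZToX A R p) (pullback.snd (family A R p) f)
      (by rw [Category.assoc, ZToX_base, pullback.condition_assoc, hf]) ≫
    (pullbackSpecIso A R B).hom

end Schemes

/-- A morphism of schemes is étale of rank `n` if it is finite, étale, and of constant
rank `n`. -/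
structure IsEtaleOfRank {X Y : Scheme.{u}} (n : ℕ) (f : X ⟶ Y) : Prop where
  isFinite : IsFinite f
  etale : Etale f
  finrank_eq : ∀ y : Y, f.finrank y = n

/-- Two morphisms to `X` are closed immersions that define the same closed subscheme of `X`. -/
def EqAsClosedSubschemes {X V W : Scheme.{u}} (i : V ⟶ X) (j : W ⟶ X) : Prop :=
  IsClosedImmersion i ∧ IsClosedImmersion j ∧ ∃ e : V ≅ W, e.hom ≫ j = i

end

end EtaleFamilies

/-! Cramer's rule carries the argument. An element `z` of `TSFix` has `n` conjugates in the tensor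
power, one for each factor, and so has each co-projection. The linear system expressing the
conjugates of `z` through those of the co-projections of `x` has determinant `α(x)`, and solving it
writes `α²(x) z` as a combination of these co-projections with symmetric coefficients
(`exists_expansion`). Hence, where `α²(x)` is invertible, the co-projections of `x` form a basis.
The conjugations evaluated on it form a matrix of invertible determinant, which produces a
separability idempotent (`etale_of_isUnit_det_evalMatrix`). The same expansion shows that a morphism
to `𝒵_R` is determined by its components in `Spec R` and `𝒰_R`, so `ZToProd` is a monomorphism; it
is also finite, hence a closed immersion.

For the universal property, a morphism from `Spec B` to `𝒰_R` over `Spec A` is a homomorphism `ν :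
TS → B` for which the images of the `α²(x)` generate the unit ideal, and the pulled-back family is a
quotient of `R ⊗ B`. Over an extension `D` of `B` to which `ν` extends as `e : TensorPow → D`, the
kernel of this quotient map is the common kernel of the `n` evaluations defined by `e`. If the
quotient is `E`, these evaluations give a map `E → Dⁿ` with spanning image. Two such maps differ by
an automorphism of `Dⁿ`, locally a permutation of the factors, so the corresponding `e` and `e'`
agree on symmetric tensors (`eq_of_splittings`). This gives uniqueness. Existence follows by
descent: `E` splits over a faithfully flat `D`, and the two pull-backs of the resulting `e` to `D ⊗
D` agree on symmetric tensors. -/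

namespace EtaleFamilies

noncomputable section

/-! ### Conjugates, alternating tensors and Cramer's rule -/

section SymmetricTensors

variable {A R : Type u} [CommRing A] [CommRing R] [Algebra A R] {n : ℕ}

/-- The co-projection of `R` on the factor `i` of the `n`-fold tensor product. -/
abbrev factor (A : Type u) {R : Type u} [CommRing A] [CommRing R] [Algebra A R] {n : ℕ}
    (i : Fin n) : R →ₐ[A] TensorPow A R n :=
  PiTensorProduct.singleAlgHom (R := A) (A := fun _ : Fin n => R) i

theorem tprod_eq_prod_factor (x : Fin n → R) :
    PiTensorProduct.tprod A x = ∏ i, factor A i (x i) := by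
  conv_lhs => rw [← Finset.univ_prod_mulSingle x]
  rw [PiTensorProduct.tprod_prod]
  rfl

theorem permute_factor (σ : Equiv.Perm (Fin n)) (i : Fin n) (r : R) :
    permute A R σ (factor A i r) = factor A (σ i) r := by
  simp only [PiTensorProduct.singleAlgHom_apply, permute_tprod]
  congr 1
  funext j
  simp [Pi.mulSingle_apply, Equiv.symm_apply_eq]

theorem permute_permute (σ τ : Equiv.Perm (Fin n)) (t : TensorPow A R n) :
    permute A R σ (permute A R τ t) = permute A R (σ * τ) t := by
  have h : (permute A R σ).comp (permute A R τ) = permute A R (σ * τ) := by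
    refine PiTensorProduct.algHom_ext fun i => AlgHom.ext fun r => ?_
    exact (congrArg _ (permute_factor τ i r)).trans
      ((permute_factor σ (τ i) r).trans (permute_factor (σ * τ) i r).symm)
  exact DFunLike.congr_fun h t

theorem permute_one (t : TensorPow A R n) : permute A R 1 t = t := by
  have h : permute A R (1 : Equiv.Perm (Fin n)) = AlgHom.id A (TensorPow A R n) :=
    PiTensorProduct.algHom_ext fun i => AlgHom.ext fun r => permute_factor 1 i r
  exact DFunLike.congr_fun h t

theorem permute_coe (σ : Equiv.Perm (Fin n)) (t : TS A R n) : permute A R σ t = t :=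
  t.2 σ (Subgroup.mem_top σ)

/-- The conjugate of a tensor invariant under the stabilizer of `p`, under any permutation that
maps `p` to `i`. -/
def conj (p i : Fin n) : TSFix A R p →ₐ[A] TensorPow A R n :=
  (permute A R (Equiv.swap p i)).comp (TSFix A R p).val

/-- Two permutations with the same value at `p` differ by an element of the stabilizer, so the
conjugates of `z` are indexed by the factors. -/
theorem permute_coe_eq_conj (p : Fin n) (σ : Equiv.Perm (Fin n)) (z : TSFix A R p) :
    permute A R σ z = conj p (σ p) z := by
  have h : (Equiv.swap p (σ p))⁻¹ * σ ∈ MulAction.stabilizer (Equiv.Perm (Fin n)) p := by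
    simp [MulAction.mem_stabilizer_iff, Equiv.swap_inv]
  have := z.2 _ h
  calc permute A R σ z
      = permute A R (Equiv.swap p (σ p)) (permute A R ((Equiv.swap p (σ p))⁻¹ * σ) z) := by
        rw [permute_permute, mul_inv_cancel_left]
    _ = conj p (σ p) z := by rw [this]; rfl

theorem conj_self (p : Fin n) (z : TSFix A R p) : conj p p z = z := by
  rw [← permute_one (z : TensorPow A R n), permute_coe_eq_conj]
  rfl

theorem permute_conj (p i : Fin n) (σ : Equiv.Perm (Fin n)) (z : TSFix A R p) :
    permute A R σ (conj p i z) = conj p (σ i) z := by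
  have h : conj p i z = permute A R (Equiv.swap p i) (z : TensorPow A R n) := rfl
  rw [h, permute_permute, permute_coe_eq_conj]
  simp

theorem conj_coproj (p i : Fin n) (r : R) : conj p i (coproj A R p r) = factor A i r := by
  have h : conj p i (coproj A R p r) = permute A R (Equiv.swap p i) (factor A p r) := rfl
  rw [h, permute_factor, Equiv.swap_apply_left]

theorem conj_inclTS (p i : Fin n) (t : TS A R n) : conj p i (inclTS A R p t) = t :=
  permute_coe _ t

variable (A) in
/-- The matrix with entries the co-projections of the members of a tuple. -/
def factorMatrix (x : Fin n → R) : Matrix (Fin n) (Fin n) (TensorPow A R n) :=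
  Matrix.of fun i j => factor A i (x j)

theorem det_factorMatrix (x : Fin n → R) : (factorMatrix A x).det = alternating A x := by
  rw [← Matrix.det_transpose, Matrix.det_apply', alternating]
  refine Finset.sum_congr rfl fun σ _ => ?_
  rw [tprod_eq_prod_factor, Algebra.smul_def, map_intCast]
  rfl

theorem coe_alternatingSq (x : Fin n → R) :
    (alternatingSq A x : TensorPow A R n) = alternating A x ^ 2 := rfl

theorem permute_det (σ : Equiv.Perm (Fin n)) (N : Matrix (Fin n) (Fin n) (TensorPow A R n))
    (hN : ∀ i j, permute A R σ (N i j) = N (σ i) j) :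
    permute A R σ N.det = ((Equiv.Perm.sign σ : ℤ) : TensorPow A R n) * N.det := by
  rw [← Matrix.det_permute σ N, AlgHom.map_det]
  congr 1
  ext i j
  simp [hN]

theorem permute_det_mul_det (σ : Equiv.Perm (Fin n))
    (N N' : Matrix (Fin n) (Fin n) (TensorPow A R n))
    (hN : ∀ i j, permute A R σ (N i j) = N (σ i) j)
    (hN' : ∀ i j, permute A R σ (N' i j) = N' (σ i) j) :
    permute A R σ (N.det * N'.det) = N.det * N'.det := by
  rw [map_mul, permute_det σ N hN, permute_det σ N' hN', mul_mul_mul_comm, ← Int.cast_mul,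
    ← Units.val_mul, Int.units_mul_self, Units.val_one, Int.cast_one, one_mul]

/-- Cramer's rule: up to the factor `α²(x)`, every tensor invariant under the stabilizer of a
factor is a combination of the co-projections of the members of `x`, with symmetric tensors as
coefficients. -/
theorem exists_expansion (p : Fin n) (x : Fin n → R) (z : TSFix A R p) :
    ∃ c : Fin n → TS A R n,
      inclTS A R p (alternatingSq A x) * z =
        ∑ j, inclTS A R p (c j) * coproj A R p (x j) := by
  set M := factorMatrix A x with hM
  have hMσ (σ : Equiv.Perm (Fin n)) (i j) : permute A R σ (M i j) = M (σ i) j :=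
    permute_factor σ i (x j)
  let b : Fin n → TensorPow A R n := fun i => conj p i z
  have hMb (σ : Equiv.Perm (Fin n)) (k i j) :
      permute A R σ (M.updateCol k b i j) = M.updateCol k b (σ i) j := by
    rw [Matrix.updateCol_apply, Matrix.updateCol_apply]
    split_ifs
    · exact permute_conj p i σ z
    · exact hMσ σ i j
  -- The Cramer numerators are only alternating; a further factor `det M` makes them symmetric,
  -- which is why `α²(x)` appears instead of `α(x)`.
  refine ⟨fun j => ⟨M.det * (M.updateCol j b).det, fun σ _ =>
    permute_det_mul_det σ _ _ (hMσ σ) (hMb σ j)⟩, Subtype.ext ?_⟩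
  have key := congrFun (Matrix.mulVec_cramer M b) p
  simp only [Matrix.mulVec, dotProduct, Matrix.cramer_apply, Pi.smul_apply, smul_eq_mul] at key
  have hb : b p = z := conj_self p z
  rw [hb, det_factorMatrix] at key
  rw [AddSubmonoidClass.coe_finsetSum]
  change alternating A x ^ 2 * (z : TensorPow A R n) =
    ∑ j, M.det * (M.updateCol j b).det * M p j
  rw [hM, det_factorMatrix, sq, mul_assoc, ← key, Finset.mul_sum]
  exact Finset.sum_congr rfl fun j _ => by ring

/-- The trace of a tensor under the symmetric group. -/
def trace (A R : Type u) [CommRing A] [CommRing R] [Algebra A R] (n : ℕ) :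
    TensorPow A R n →ₗ[TS A R n] TS A R n where
  toFun t := ⟨∑ σ, permute A R σ t, fun τ _ => by
    rw [map_sum]
    exact Fintype.sum_equiv (Equiv.mulLeft τ) _ _ fun σ => permute_permute τ σ t⟩
  map_add' s t := Subtype.ext (by simp [Finset.sum_add_distrib])
  map_smul' c t := Subtype.ext (by
    simp only [Algebra.smul_def, map_mul, RingHom.id_apply,
      MulMemClass.coe_mul, Finset.mul_sum]
    exact Finset.sum_congr rfl fun σ _ => congrArg (· * _) (permute_coe σ c))

/-- Exhibiting `α²(x)` as a trace is what makes base changes of the tensor power injective wherever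
the `α²(x)` generate the unit ideal. -/
theorem trace_alternating_mul_tprod (x : Fin n → R) :
    trace A R n (alternating A x * PiTensorProduct.tprod A x) = alternatingSq A x := by
  refine Subtype.ext ?_
  change ∑ σ, permute A R σ (alternating A x * PiTensorProduct.tprod A x) = alternating A x ^ 2
  rw [sq]
  nth_rw 3 [alternating]
  rw [Finset.mul_sum]
  refine Fintype.sum_equiv (Equiv.inv _) _ _ fun σ => ?_
  rw [map_mul, permute_alternating, permute_tprod, Equiv.inv_apply, Equiv.Perm.sign_inv,
    smul_mul_assoc, mul_smul_comm]
  rfl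

/-- The Gram matrix `Mᵀ M` of the matrix `M` of co-projections of a tuple. -/
def gram (x : Fin n → R) : Matrix (Fin n) (Fin n) (TS A R n) :=
  Matrix.of fun j k => ⟨((factorMatrix A x).transpose * factorMatrix A x) j k, fun σ _ => by
    simp only [Matrix.mul_apply, Matrix.transpose_apply, map_sum, map_mul]
    refine Fintype.sum_equiv σ _ _ fun i => ?_
    exact congrArg₂ _ (permute_factor σ i (x j)) (permute_factor σ i (x k))⟩

theorem map_gram (x : Fin n → R) :
    (gram (A := A) x).map (algebraMap (TS A R n) (TensorPow A R n)) =
      (factorMatrix A x).transpose * factorMatrix A x := rfl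

theorem det_gram (x : Fin n → R) : (gram x).det = alternatingSq A x := by
  refine Subtype.ext ?_
  change algebraMap (TS A R n) (TensorPow A R n) (gram (A := A) x).det = _
  rw [RingHom.map_det, RingHom.mapMatrix_apply, map_gram, Matrix.det_mul, Matrix.det_transpose,
    det_factorMatrix, coe_alternatingSq, sq]

end SymmetricTensors

theorem eq_zero_of_forall_smul_eq_zero {C M ι : Type*} [CommRing C] [AddCommGroup M] [Module C M]
    {a : ι → C} (ha : Ideal.span (Set.range a) = ⊤) {m : M} (h : ∀ i, a i • m = 0) : m = 0 := by
  refine (Submodule.mem_bot C).1 (Submodule.mem_of_span_top_of_smul_mem ⊥ _ ha m ?_)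
  rintro ⟨_, i, rfl⟩
  exact (Submodule.mem_bot C).2 (h i)

/-! ### Base change along a homomorphism from the symmetric tensors -/

section BaseChange

variable {A R : Type u} [CommRing A] [CommRing R] [Algebra A R] {n : ℕ}

/-- The images of the tensors `α²(x)` generate the unit ideal. -/
def IsNondegenerate {C : Type*} [CommRing C] (ν : TS A R n →+* C) : Prop :=
  Ideal.span (Set.range fun x : Fin n → R => ν (alternatingSq A x)) = ⊤

theorem IsNondegenerate.comp {C D : Type*} [CommRing C] [CommRing D] {ν : TS A R n →+* C}
    (hν : IsNondegenerate ν) (g : C →+* D) : IsNondegenerate (g.comp ν) := by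
  have h := congrArg (Ideal.map g) hν
  rwa [Ideal.map_span, Ideal.map_top, ← Set.range_comp] at h

theorem isNondegenerate_of_isUnit {C : Type*} [CommRing C] {ν : TS A R n →+* C} (x : Fin n → R)
    (h : IsUnit (ν (alternatingSq A x))) : IsNondegenerate ν :=
  Ideal.eq_top_of_isUnit_mem _ (Ideal.subset_span ⟨x, rfl⟩) h

instance algebraTSFix (p : Fin n) : Algebra (TS A R n) (TSFix A R p) :=
  (inclTS A R p).toRingHom.toAlgebra

theorem algebraMap_TSFix (p : Fin n) (t : TS A R n) :
    algebraMap (TS A R n) (TSFix A R p) t = inclTS A R p t := rfl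

instance (p : Fin n) : IsScalarTower A (TS A R n) (TSFix A R p) :=
  IsScalarTower.of_algebraMap_eq fun a => ((inclTS A R p).commutes a).symm

section

variable {C : Type u} [CommRing C] [Algebra (TS A R n) C]

/-- If `b` dies in the base change, then so does `b ⊗ (α(x) · tprod x)`; applying the trace gives
`α²(x) b = 0` for every `x`. -/
theorem algebraMap_tensorPow_injective
    (hC : IsNondegenerate (algebraMap (TS A R n) C)) :
    Function.Injective (algebraMap C (C ⊗[TS A R n] TensorPow A R n)) := by
  rw [injective_iff_map_eq_zero]
  intro b hb
  refine eq_zero_of_forall_smul_eq_zero hC fun x => ?_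
  let l : C ⊗[TS A R n] TensorPow A R n →ₗ[TS A R n] C :=
    (TensorProduct.rid (TS A R n) C).toLinearMap ∘ₗ (trace A R n).lTensor C
  have h : b ⊗ₜ[TS A R n] (alternating A x * PiTensorProduct.tprod A x) = 0 := by
    have h₁ : algebraMap C (C ⊗[TS A R n] TensorPow A R n) b *
        ((1 : C) ⊗ₜ[TS A R n] (alternating A x * PiTensorProduct.tprod A x)) = 0 := by
      rw [hb, zero_mul]
    rwa [Algebra.TensorProduct.algebraMap_apply, Algebra.algebraMap_self_apply,
      Algebra.TensorProduct.tmul_mul_tmul, mul_one, one_mul] at h₁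
  have h₂ := congrArg l h
  rw [map_zero] at h₂
  simpa [l, trace_alternating_mul_tprod, Algebra.smul_def] using h₂

/-- The co-projection on the factor `p`, as a map to a base change of the tensors invariant under
the permutations that fix `p`. -/
abbrev coprojTensor (C : Type u) [CommRing C] [Algebra (TS A R n) C] (p : Fin n) (r : R) :
    C ⊗[TS A R n] TSFix A R p :=
  1 ⊗ₜ coproj A R p r

theorem exists_expansion_tensor (p : Fin n) (x : Fin n → R) (w : C ⊗[TS A R n] TSFix A R p) :
    ∃ b : Fin n → C, algebraMap (TS A R n) C (alternatingSq A x) • w =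
      ∑ j, b j • coprojTensor C p (x j) := by
  induction w with
  | zero => exact ⟨0, by simp⟩
  | add w₁ w₂ h₁ h₂ =>
    obtain ⟨b₁, h₁⟩ := h₁
    obtain ⟨b₂, h₂⟩ := h₂
    exact ⟨b₁ + b₂, by simp only [smul_add, h₁, h₂, Pi.add_apply, add_smul,
      Finset.sum_add_distrib]⟩
  | tmul c z =>
    obtain ⟨d, hd⟩ := exists_expansion p x z
    refine ⟨fun j => c * algebraMap (TS A R n) C (d j), ?_⟩
    have h (t : TS A R n) (y : TSFix A R p) :
        (c * algebraMap (TS A R n) C t) ⊗ₜ[TS A R n] y = c ⊗ₜ (inclTS A R p t * y) := by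
      rw [mul_comm, ← Algebra.smul_def, TensorProduct.smul_tmul, Algebra.smul_def,
        algebraMap_TSFix]
    rw [TensorProduct.smul_tmul', smul_eq_mul, mul_comm, h, hd, TensorProduct.tmul_sum]
    refine Finset.sum_congr rfl fun j _ => ?_
    rw [← h, TensorProduct.smul_tmul', smul_eq_mul, mul_one]

variable {D : Type u} [CommRing D] [Algebra C D] [Algebra (TS A R n) D]
  [IsScalarTower (TS A R n) C D] (e : TensorPow A R n →ₐ[TS A R n] D)

variable (C) in
/-- The extension of the conjugation `conj p i` to a base change. -/
def conjTensor (p i : Fin n) : C ⊗[TS A R n] TSFix A R p →ₐ[C] D :=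
  Algebra.TensorProduct.lift (Algebra.ofId C D)
    { toRingHom := e.toRingHom.comp (conj p i).toRingHom
      commutes' := fun t => (congrArg e (conj_inclTS p i t)).trans (e.commutes t) }
    (fun _ _ => Commute.all _ _)

theorem conjTensor_tmul (p i : Fin n) (c : C) (z : TSFix A R p) :
    conjTensor C e p i (c ⊗ₜ z) = algebraMap C D c * e (conj p i z) :=
  Algebra.TensorProduct.lift_tmul ..

theorem conjTensor_coprojTensor (p i : Fin n) (r : R) :
    conjTensor C e p i (coprojTensor C p r) = e (factor A i r) := by
  rw [conjTensor_tmul, map_one, one_mul, conj_coproj]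

theorem det_map_factorMatrix (x : Fin n → R) :
    ((factorMatrix A x).map e).det = e (alternating A x) := by
  rw [← det_factorMatrix]
  exact (AlgHom.map_det e _).symm

theorem map_alternating_sq (x : Fin n → R) :
    e (alternating A x) ^ 2 =
      algebraMap C D (algebraMap (TS A R n) C (alternatingSq A x)) := by
  rw [← IsScalarTower.algebraMap_apply, ← e.commutes, ← map_pow]
  rfl

/-- The adjugate turns the system into `α(x) b = 0` over `D`; one more factor `α(x)` gives a
relation with coefficients in `C`, where injectivity applies. -/
theorem smul_eq_zero_of_forall_sum_eq_zero (hD : Function.Injective (algebraMap C D))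
    (x : Fin n → R) (b : Fin n → C)
    (h : ∀ i, ∑ j, e (factor A i (x j)) * algebraMap C D (b j) = 0) (j : Fin n) :
    algebraMap (TS A R n) C (alternatingSq A x) * b j = 0 := by
  apply hD
  have h₁ : ((factorMatrix A x).map e).mulVec (fun j => algebraMap C D (b j)) = 0 :=
    funext h
  have h₂ := congrArg (fun v => ((factorMatrix A x).map e).adjugate.mulVec v) h₁
  simp only [Matrix.mulVec_mulVec, Matrix.adjugate_mul, Matrix.smul_mulVec, Matrix.one_mulVec,
    Matrix.mulVec_zero, det_map_factorMatrix] at h₂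
  have h₃ := congrFun h₂ j
  simp only [Pi.smul_apply, Pi.zero_apply, smul_eq_mul] at h₃
  rw [map_mul, ← map_alternating_sq e, sq, mul_assoc, h₃, mul_zero, map_zero]

theorem eq_zero_of_forall_conjTensor_eq_zero
    (hC : IsNondegenerate (algebraMap (TS A R n) C)) (hD : Function.Injective (algebraMap C D))
    (p : Fin n) {w : C ⊗[TS A R n] TSFix A R p} (hw : ∀ i, conjTensor C e p i w = 0) :
    w = 0 := by
  -- One factor `α²(x)` expands `w`, and a second one kills the coefficients of the expansion, so
  -- the squares of the `α²(x)` are used.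
  have hC₂ := Ideal.span_pow_eq_top _ hC 2
  rw [← Set.range_comp] at hC₂
  refine eq_zero_of_forall_smul_eq_zero hC₂ fun x => ?_
  rw [Function.comp_apply, sq, mul_smul]
  obtain ⟨b, hb⟩ := exists_expansion_tensor p x w
  have h (j) : algebraMap (TS A R n) C (alternatingSq A x) * b j = 0 := by
    refine smul_eq_zero_of_forall_sum_eq_zero e hD x b (fun i => ?_) j
    have := congrArg (conjTensor C e p i) hb
    rw [map_smul, hw, smul_zero, map_sum] at this
    rw [this]
    refine Finset.sum_congr rfl fun j _ => ?_
    rw [map_smul, conjTensor_coprojTensor, Algebra.smul_def, mul_comm]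
  rw [hb, Finset.smul_sum]
  exact Finset.sum_eq_zero fun j _ => by rw [smul_smul, h, zero_smul]

end

end BaseChange

/-! ### Étaleness from sufficiently many homomorphisms -/

section SeparatingHomomorphisms

variable {ι C S D : Type*} [CommRing C] [CommRing S] [CommRing D] [Algebra C S] [Algebra C D]
  (β : Module.Basis ι C S) (φ : ι → S →ₐ[C] D)

/-- The matrix of values of a family of homomorphisms on a basis. -/
def evalMatrix : Matrix ι ι D := Matrix.of fun i j => φ i (β j)

/-- The product of two homomorphisms of a family, on the tensor square. -/
def evalSq (i k : ι) : S ⊗[C] S →ₐ[C] D :=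
  Algebra.TensorProduct.lift (φ i) (φ k) (fun _ _ => Commute.all _ _)

theorem evalSq_tmul (i k : ι) (v w : S) : evalSq φ i k (v ⊗ₜ w) = φ i v * φ k w :=
  Algebra.TensorProduct.lift_tmul ..

variable [Fintype ι] [DecidableEq ι] {β φ}

theorem eq_zero_of_forall_eval_eq_zero (hD : Function.Injective (algebraMap C D))
    (hM : IsUnit (evalMatrix β φ).det) {s : S} (hs : ∀ i, φ i s = 0) : s = 0 := by
  have h : (evalMatrix β φ).mulVec (fun j => algebraMap C D (β.repr s j)) = 0 := by
    funext i
    rw [Pi.zero_apply, ← hs i]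
    conv_rhs => rw [← β.sum_repr s, map_sum]
    refine Finset.sum_congr rfl fun j _ => ?_
    rw [map_smul, Algebra.smul_def, mul_comm]
    rfl
  have h' := Matrix.mulVec_injective_of_isUnit ((Matrix.isUnit_iff_isUnit_det _).2 hM)
    (h.trans (Matrix.mulVec_zero _).symm)
  refine β.ext_elem fun j => hD ?_
  rw [map_zero, Finsupp.zero_apply, map_zero]
  exact congrFun h' j

/-- With `N` the coordinate matrix of `w` and `M` the evaluation matrix, the hypothesis reads `M N
Mᵀ = 0`, and `M` is invertible. -/
theorem eq_zero_of_forall_evalSq_eq_zero (hD : Function.Injective (algebraMap C D))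
    (hM : IsUnit (evalMatrix β φ).det) {w : S ⊗[C] S} (hw : ∀ i k, evalSq φ i k w = 0) :
    w = 0 := by
  set M := evalMatrix β φ
  set N : Matrix ι ι D :=
    Matrix.of fun j l => algebraMap C D ((β.tensorProduct β).repr w (j, l)) with hN
  have h : M * N * M.transpose = 0 := by
    ext i k
    rw [Matrix.zero_apply, ← hw i k, Matrix.mul_apply]
    conv_rhs => rw [← (β.tensorProduct β).sum_repr w, map_sum, Fintype.sum_prod_type]
    simp only [Matrix.mul_apply, Finset.sum_mul]
    rw [Finset.sum_comm]
    refine Finset.sum_congr rfl fun j _ => Finset.sum_congr rfl fun l _ => ?_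
    rw [map_smul, Module.Basis.tensorProduct_apply, evalSq_tmul, Algebra.smul_def,
      mul_comm (M i j), mul_assoc]
    rfl
  have hM' : IsUnit M := (Matrix.isUnit_iff_isUnit_det _).2 hM
  have hMt : IsUnit M.transpose :=
    (Matrix.isUnit_iff_isUnit_det _).2 (by rwa [Matrix.det_transpose])
  have hN0 : N = 0 := hM'.mul_right_eq_zero.1 (hMt.mul_left_eq_zero.1 h)
  refine (β.tensorProduct β).ext_elem fun jl => hD ?_
  rw [map_zero, Finsupp.zero_apply, map_zero]
  exact congrFun (congrFun hN0 jl.1) jl.2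

/-- A free algebra is étale if it has as many homomorphisms to an extension of the base ring as
its rank, such that their values on a basis form an invertible matrix. -/
theorem etale_of_isUnit_det_evalMatrix (hD : Function.Injective (algebraMap C D))
    (hM : IsUnit (evalMatrix β φ).det) (G : Matrix ι ι C) (hG : IsUnit G.det)
    (hGM : G.map (algebraMap C D) = (evalMatrix β φ).transpose * evalMatrix β φ) :
    Algebra.Etale C S := by
  have : Module.Free C S := .of_basis β
  have : Module.Finite C S := .of_basis β
  have : Module.FinitePresentation C S := Module.finitePresentation_of_projective C S
  have : Algebra.FinitePresentation C S := .of_finitePresentation C S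
  have hM' : evalMatrix β φ * (G⁻¹).map (algebraMap C D) * (evalMatrix β φ).transpose = 1 := by
    rw [mul_eq_one_comm, ← mul_assoc, ← hGM, ← Matrix.map_mul, Matrix.mul_nonsing_inv G hG]
    simp
  -- This is the separability idempotent: since `M G⁻¹ Mᵀ = 1`, its value under the pair `(φ i, φ
  -- k)` is the Kronecker delta. Both conditions of the unramifiedness criterion can then be tested
  -- on values.
  let t : S ⊗[C] S := ∑ j, ∑ l, G⁻¹ j l • (β j ⊗ₜ β l)
  have ht (i k : ι) : evalSq φ i k t = (1 : Matrix ι ι D) i k := by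
    simp only [← hM', t, map_sum, map_smul, evalSq_tmul, Matrix.mul_apply, Finset.sum_mul,
      Matrix.map_apply, Matrix.transpose_apply]
    rw [Finset.sum_comm]
    refine Finset.sum_congr rfl fun l _ => Finset.sum_congr rfl fun j _ => ?_
    rw [Algebra.smul_def, mul_comm (evalMatrix β φ i j), mul_assoc]
    rfl
  have : Algebra.FormallyUnramified C S := by
    refine Algebra.FormallyUnramified.iff_exists_tensorProduct.2 ⟨t, fun s => ?_, ?_⟩
    · refine eq_zero_of_forall_evalSq_eq_zero hD hM fun i k => ?_
      rw [map_mul, ht, map_sub, evalSq_tmul, evalSq_tmul, map_one, map_one, one_mul, mul_one]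
      obtain rfl | h := eq_or_ne i k
      · rw [sub_self, zero_mul]
      · rw [Matrix.one_apply_ne h, mul_zero]
    · rw [← sub_eq_zero]
      refine eq_zero_of_forall_eval_eq_zero hD hM fun i => ?_
      have h : (φ i).comp (Algebra.TensorProduct.lmul' C) = evalSq φ i i :=
        Algebra.TensorProduct.ext' fun v w => by
          rw [AlgHom.comp_apply, Algebra.TensorProduct.lmul'_apply_tmul, map_mul, evalSq_tmul]
      have h' := DFunLike.congr_fun h t
      rw [AlgHom.comp_apply, ht, Matrix.one_apply_eq] at h'
      rw [map_sub, h', map_one, sub_self]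
  exact Algebra.Etale.of_formallyUnramified_of_flat

end SeparatingHomomorphisms

/-! ### Bases and étaleness where `α²(x)` is invertible -/

section EtaleBaseChange

variable {A R : Type u} [CommRing A] [CommRing R] [Algebra A R] {n : ℕ}
  {C : Type u} [CommRing C] [Algebra (TS A R n) C]

theorem span_coprojTensor_eq_top (hC : IsNondegenerate (algebraMap (TS A R n) C)) (p : Fin n) :
    Submodule.span C (Set.range (coprojTensor C p : R → C ⊗[TS A R n] TSFix A R p)) = ⊤ := by
  refine Submodule.eq_top_iff'.2 fun w => Submodule.mem_of_span_top_of_smul_mem _ _ hC w ?_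
  rintro ⟨_, x, rfl⟩
  obtain ⟨b, hb⟩ := exists_expansion_tensor (C := C) p x w
  refine Set.mem_of_eq_of_mem hb ?_
  exact Submodule.sum_mem _ fun j _ => Submodule.smul_mem _ _ (Submodule.subset_span ⟨x j, rfl⟩)

/-- If `α²(x)` becomes invertible, then the co-projections of the members of `x` form a basis. -/
def coprojBasis (p : Fin n) (x : Fin n → R)
    (hx : IsUnit (algebraMap (TS A R n) C (alternatingSq A x))) :
    Module.Basis (Fin n) C (C ⊗[TS A R n] TSFix A R p) :=
  Module.Basis.mk (v := fun j => coprojTensor C p (x j))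
    (by
      rw [Fintype.linearIndependent_iff]
      intro b hb j
      have hD := algebraMap_tensorPow_injective (isNondegenerate_of_isUnit x hx)
      refine hx.mul_right_eq_zero.1 (smul_eq_zero_of_forall_sum_eq_zero
        (Algebra.TensorProduct.includeRight : _ →ₐ[TS A R n] C ⊗[TS A R n] TensorPow A R n)
        hD x b (fun i => ?_) j)
      have := congrArg (conjTensor C (Algebra.TensorProduct.includeRight :
        _ →ₐ[TS A R n] C ⊗[TS A R n] TensorPow A R n) p i) hb
      rw [map_sum, map_zero] at this
      rw [← this]
      refine Finset.sum_congr rfl fun j _ => ?_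
      rw [map_smul, conjTensor_coprojTensor, Algebra.smul_def, mul_comm])
    (fun w _ => by
      obtain ⟨b, hb⟩ := exists_expansion_tensor p x w
      rw [← (Submodule.smul_mem_iff_of_isUnit _ hx), hb]
      exact Submodule.sum_mem _ fun j _ =>
        Submodule.smul_mem _ _ (Submodule.subset_span ⟨j, rfl⟩))

theorem coprojBasis_apply (p : Fin n) (x : Fin n → R)
    (hx : IsUnit (algebraMap (TS A R n) C (alternatingSq A x))) (j : Fin n) :
    coprojBasis p x hx j = coprojTensor C p (x j) := by
  simp [coprojBasis]

theorem etale_of_isUnit (p : Fin n) (x : Fin n → R)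
    (hx : IsUnit (algebraMap (TS A R n) C (alternatingSq A x))) :
    Algebra.Etale C (C ⊗[TS A R n] TSFix A R p) := by
  have hD : Function.Injective (algebraMap C (C ⊗[TS A R n] TensorPow A R n)) :=
    algebraMap_tensorPow_injective (isNondegenerate_of_isUnit x hx)
  let e : TensorPow A R n →ₐ[TS A R n] C ⊗[TS A R n] TensorPow A R n :=
    Algebra.TensorProduct.includeRight
  have hM : evalMatrix (coprojBasis p x hx) (conjTensor C e p) = (factorMatrix A x).map e := by
    ext i j
    rw [evalMatrix, Matrix.of_apply, coprojBasis_apply, conjTensor_coprojTensor]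
    rfl
  -- The evaluation matrix has determinant `α(x)`, whose square is a unit, and its Gram matrix
  -- already has symmetric entries.
  refine etale_of_isUnit_det_evalMatrix (β := coprojBasis p x hx) (φ := conjTensor C e p) hD ?_
    ((gram (A := A) x).map (algebraMap (TS A R n) C)) ?_ ?_
  · rw [hM, det_map_factorMatrix]
    refine (isUnit_pow_iff two_ne_zero).1 ?_
    rw [map_alternating_sq (C := C) e]
    exact hx.map _
  · rw [← RingHom.mapMatrix_apply, ← RingHom.map_det, det_gram]
    exact hx
  · rw [hM]
    ext j k
    have h : e (algebraMap (TS A R n) (TensorPow A R n) (gram x j k)) =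
        algebraMap C (C ⊗[TS A R n] TensorPow A R n)
          ((gram (A := A) x).map (algebraMap (TS A R n) C) j k) := by
      rw [e.commutes, IsScalarTower.algebraMap_apply _ C (C ⊗[TS A R n] TensorPow A R n)]
      rfl
    rw [Matrix.map_apply, ← h]
    change e (((factorMatrix A x).transpose * factorMatrix A x) j k) = _
    rw [Matrix.mul_apply, map_sum, Matrix.mul_apply]
    exact Finset.sum_congr rfl fun i _ => map_mul e _ _

end EtaleBaseChange

/-! ### Splittings into powers and their values on symmetric tensors -/

section Splittings

variable {A R : Type u} [CommRing A] [CommRing R] [Algebra A R] {n : ℕ}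

section Nondegenerate

variable {D : Type u} [CommRing D] [Algebra A D] (e : TensorPow A R n →ₐ[A] D)

/-- The values of the `n` co-projections of an element under a homomorphism. -/
def factorValues (r : R) : Fin n → D := fun i => e (factor A i r)

/-- The `α(x)` are the maximal minors of the family of vectors `factorValues e r`: Cramer's rule
gives one direction, and linear algebra over residue fields the other. -/
theorem isNondegenerate_comp_iff :
    IsNondegenerate (e.toRingHom.comp (algebraMap (TS A R n) (TensorPow A R n))) ↔
      Submodule.span D (Set.range (factorValues e)) = ⊤ := by
  have hdet (x : Fin n → R) : ((factorMatrix A x).map e).det = e (alternating A x) := by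
    rw [← det_factorMatrix]
    exact (AlgHom.map_det e _).symm
  have hsq (x : Fin n → R) :
      e.toRingHom.comp (algebraMap (TS A R n) (TensorPow A R n)) (alternatingSq A x) =
        e (alternating A x) ^ 2 := map_pow e _ _
  constructor
  · intro h
    refine Submodule.eq_top_iff'.2 fun v => Submodule.mem_of_span_top_of_smul_mem _ _ h v ?_
    rintro ⟨_, x, rfl⟩
    set M := (factorMatrix A x).map e with hM
    have h₁ : (e (alternating A x) ^ 2) • v =
        ∑ j, (e (alternating A x) * M.cramer v j) • factorValues e (x j) := by
      have h₂ := Matrix.mulVec_cramer M v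
      rw [hM, hdet] at h₂
      funext i
      rw [sq, mul_smul, ← h₂, Finset.sum_apply, Pi.smul_apply, Matrix.mulVec, dotProduct,
        Finset.smul_sum]
      refine Finset.sum_congr rfl fun j _ => ?_
      rw [Pi.smul_apply, smul_eq_mul, smul_eq_mul, mul_assoc, mul_comm (M.cramer v j)]
      rfl
    change e.toRingHom.comp (algebraMap (TS A R n) (TensorPow A R n)) (alternatingSq A x) • v ∈ _
    rw [hsq, h₁]
    exact Submodule.sum_mem _ fun j _ => Submodule.smul_mem _ _ (Submodule.subset_span ⟨x j, rfl⟩)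
  · intro h
    by_contra hne
    obtain ⟨m, hm, hle⟩ := Ideal.exists_le_maximal _ hne
    let _ : Field (D ⧸ m) := Ideal.Quotient.field m
    let π : (Fin n → D) →ₛₗ[Ideal.Quotient.mk m] (Fin n → D ⧸ m) :=
      { toFun := fun v i => Ideal.Quotient.mk m (v i)
        map_add' := fun v w => funext fun i => map_add _ _ _
        map_smul' := fun c v => funext fun i => map_mul _ _ _ }
    have hspan : Submodule.span (D ⧸ m) (Set.range fun r => π (factorValues e r)) = ⊤ := by
      refine Submodule.eq_top_iff'.2 fun v => ?_
      obtain ⟨w, rfl⟩ : ∃ w, π w = v :=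
        ⟨fun i => (Ideal.Quotient.mk_surjective (v i)).choose,
          funext fun i => (Ideal.Quotient.mk_surjective (v i)).choose_spec⟩
      have hw : w ∈ Submodule.span D (Set.range (factorValues e)) := h ▸ Submodule.mem_top
      induction hw using Submodule.span_induction with
      | mem w hw =>
        obtain ⟨r, rfl⟩ := hw
        exact Submodule.subset_span ⟨r, rfl⟩
      | zero => rw [map_zero]; exact Submodule.zero_mem _
      | add v w _ _ hv hw => rw [map_add]; exact Submodule.add_mem _ hv hw
      | smul c v _ hv => rw [map_smulₛₗ]; exact Submodule.smul_mem _ _ hv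
    -- A spanning family over the residue field contains `n` independent vectors, and their
    -- determinant is a nonzero value of some `α(x)` modulo `m`.
    have key := Submodule.exists_fun_fin_finrank_span_eq (D ⧸ m) (Set.range fun r => π (factorValues e r))
    rw [hspan, finrank_top, Module.finrank_fin_fun] at key
    obtain ⟨f, hf, -, hli⟩ := key
    choose x hx using hf
    have hu := Matrix.linearIndependent_rows_iff_isUnit.1 (show LinearIndependent (D ⧸ m)
      (Matrix.of f).row from hli)
    have hf' : Matrix.of f = (((factorMatrix A x).map e).map (Ideal.Quotient.mk m)).transpose := by
      ext j i
      exact (congrFun (hx j) i).symm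
    rw [Matrix.isUnit_iff_isUnit_det, hf', Matrix.det_transpose, ← RingHom.mapMatrix_apply,
      ← RingHom.map_det, hdet] at hu
    have hmem := hle (Ideal.subset_span ⟨x, rfl⟩)
    simp only [hsq] at hmem
    exact hu.ne_zero (Ideal.Quotient.eq_zero_iff_mem.2 (hm.isPrime.mem_of_pow_mem 2 hmem))

end Nondegenerate

section Permutations

variable {D : Type u} [CommRing D] [Algebra A D] (e e' : TensorPow A R n →ₐ[A] D)

/-- Two homomorphisms from a tensor power agree on symmetric tensors if their co-projections are
related by a permutation locally on the target. -/
theorem eq_of_factorValues_eq_mulVec (P : Matrix (Fin n) (Fin n) D)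
    (hP : ∀ i r, e' (factor A i r) = ∑ j, P i j * e (factor A j r))
    (hrow : ∀ i, ∑ j, P i j = 1) (hcol : ∀ i k j, i ≠ k → P i j * P k j = 0)
    (t : TS A R n) : e' t = e t := by
  -- Orthogonality within columns kills every product along a non-injective map, so only
  -- permutations survive when a product of row sums is expanded.
  have hvanish (f : Fin n → Fin n) (hf : f ∉ Set.range fun σ : Equiv.Perm (Fin n) => ⇑σ) :
      ∏ i, P i (f i) = 0 := by
    have hinj : ¬ Function.Injective f := fun h =>
      hf ⟨Equiv.ofBijective f (Finite.injective_iff_bijective.1 h), rfl⟩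
    obtain ⟨i, k, hik, hne⟩ := Function.not_injective_iff.1 hinj
    rw [← Finset.mul_prod_erase Finset.univ _ (Finset.mem_univ i),
      ← Finset.mul_prod_erase (Finset.univ.erase i) _
        (Finset.mem_erase.2 ⟨hne.symm, Finset.mem_univ k⟩), ← mul_assoc, hik, hcol i k _ hne,
      zero_mul]
  have hsum (F : (Fin n → Fin n) → D) :
      ∑ f, (∏ i, P i (f i)) * F f = ∑ σ : Equiv.Perm (Fin n), (∏ i, P i (σ i)) * F σ :=
    (Fintype.sum_of_injective (fun σ : Equiv.Perm (Fin n) => (σ : Fin n → Fin n))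
      DFunLike.coe_injective _ _ (fun f hf => by rw [hvanish f hf, zero_mul])
      (fun _ => rfl)).symm
  have hone : ∑ σ : Equiv.Perm (Fin n), ∏ i, P i (σ i) = 1 := by
    have h := hsum fun _ => 1
    simp only [mul_one] at h
    have h' : ∏ i, ∑ j, P i j = 1 := Finset.prod_eq_one fun i _ => hrow i
    have h'' := Finset.prod_univ_sum (fun _ : Fin n => Finset.univ) fun i (j : Fin n) => P i j
    rw [Fintype.piFinset_univ] at h''
    exact h.symm.trans (h''.symm.trans h')
  -- Thus `e'` is a weighted sum of the maps `e ∘ permute σ`, with weights of sum `1`; on symmetric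
  -- tensors these maps all coincide.
  have key (y : TensorPow A R n) :
      e' y = ∑ σ : Equiv.Perm (Fin n), (∏ i, P i (σ i)) * e (permute A R σ y) := by
    induction y using PiTensorProduct.induction_on with
    | smul_tprod a x =>
      simp only [map_smul, mul_smul_comm, ← Finset.smul_sum]
      congr 1
      simp only [tprod_eq_prod_factor, map_prod, hP, permute_factor]
      rw [Finset.prod_univ_sum, Fintype.piFinset_univ, ← hsum fun f => ∏ i, e (factor A (f i) (x i))]
      simp only [Finset.prod_mul_distrib]
    | add y z hy hz =>
      simp only [map_add, hy, hz, mul_add, Finset.sum_add_distrib]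
  rw [key]
  simp only [permute_coe]
  rw [← Finset.sum_mul, hone, one_mul]

end Permutations

section

variable {B E D : Type u} [CommRing B] [CommRing E] [CommRing D] [Algebra B E] [Algebra B D]

/-- The linear extension of a homomorphism to a product of copies of an extension. -/
def splitLift (s : E →ₐ[B] (Fin n → D)) : D ⊗[B] E →ₐ[D] (Fin n → D) :=
  Algebra.TensorProduct.lift (Algebra.ofId D _) s (fun _ _ => Commute.all _ _)

theorem splitLift_tmul (s : E →ₐ[B] (Fin n → D)) (d : D) (z : E) :
    splitLift s (d ⊗ₜ z) = d • s z :=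
  (Algebra.TensorProduct.lift_tmul ..).trans (Algebra.smul_def _ _).symm

theorem splitLift_surjective (s : E →ₐ[B] (Fin n → D))
    (hs : Submodule.span D (Set.range s) = ⊤) : Function.Surjective (splitLift s) := by
  change Function.Surjective (splitLift s).toLinearMap
  rw [← LinearMap.range_eq_top, eq_top_iff, ← hs, Submodule.span_le]
  rintro _ ⟨z, rfl⟩
  exact ⟨1 ⊗ₜ z, (splitLift_tmul s 1 z).trans (one_smul _ _)⟩

/-- Both sides have rank `n`, so surjectivity suffices. -/
theorem splitLift_bijective [Module.Finite B E] [Module.Flat B E]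
    (hE : ∀ b : PrimeSpectrum B, Module.rankAtStalk (R := B) E b = n)
    (s : E →ₐ[B] (Fin n → D)) (hs : Submodule.span D (Set.range s) = ⊤) :
    Function.Bijective (splitLift s) := by
  refine Module.bijective_of_surjective_of_rankAtStalk_eq (φ := (splitLift s).toLinearMap)
    (splitLift_surjective s hs) fun m hm => ?_
  have : Nontrivial D := ⟨0, 1, fun h => hm.ne_top (Ideal.eq_top_iff_one m |>.2 (h ▸ m.zero_mem))⟩
  rw [Module.rankAtStalk_baseChange, hE, Module.rankAtStalk_eq_finrank_of_free]
  simp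

theorem exists_matrix_of_span_eq_top [Module.Finite B E] [Module.Flat B E]
    (hE : ∀ b : PrimeSpectrum B, Module.rankAtStalk (R := B) E b = n)
    (s s' : E →ₐ[B] (Fin n → D)) (hs : Submodule.span D (Set.range s) = ⊤)
    (hs' : Submodule.span D (Set.range s') = ⊤) :
    ∃ P : Matrix (Fin n) (Fin n) D, (∀ i z, s' z i = ∑ j, P i j * s z j) ∧
      (∀ i, ∑ j, P i j = 1) ∧ ∀ i k j, i ≠ k → P i j * P k j = 0 := by
  let L := AlgEquiv.ofBijective _ (splitLift_bijective hE s hs)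
  let Φ : (Fin n → D) →ₐ[D] (Fin n → D) := (splitLift s').comp L.symm.toAlgHom
  have hΦ : Function.Surjective Φ := (splitLift_surjective s' hs').comp L.symm.surjective
  have hΦs (z : E) : Φ (s z) = s' z := by
    have : L.symm (s z) = 1 ⊗ₜ z :=
      L.symm_apply_eq.2 ((splitLift_tmul s 1 z).trans (one_smul _ _)).symm
    change splitLift s' (L.symm (s z)) = _
    rw [this, splitLift_tmul, one_smul]
  have hsum (v : Fin n → D) (i : Fin n) : Φ v i = ∑ j, Φ (Pi.single j 1) i * v j := by
    conv_lhs => rw [pi_eq_sum_univ' v, map_sum, Finset.sum_apply]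
    refine Finset.sum_congr rfl fun j _ => ?_
    rw [map_smul, Pi.smul_apply, smul_eq_mul, mul_comm]
  refine ⟨Matrix.of fun i j => Φ (Pi.single j 1) i, fun i z => ?_, fun i => ?_,
    fun i k j hik => ?_⟩
  · rw [← hΦs, hsum]
    rfl
  · have := hsum 1 i
    simp only [map_one, Pi.one_apply, mul_one] at this
    exact this.symm
  -- Multiplying `Φ (single j 1)` by `Φ v = single i 1` rescales it by `v j`. Coordinates `i` and
  -- `k` give `P i j = v j * P i j` and `0 = v j * P k j`, so the product `P i j * P k j` vanishes.
  · obtain ⟨v, hv⟩ := hΦ (Pi.single i 1)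
    have h : Φ (Pi.single j 1) * Pi.single i 1 = v j • Φ (Pi.single j 1) := by
      rw [← hv, ← map_mul, ← map_smul]
      congr 1
      funext l
      obtain rfl | hl := eq_or_ne l j
      · simp
      · simp [hl]
    have hi := congrFun h i
    have hk := congrFun h k
    simp only [Pi.mul_apply, Pi.single_eq_same, mul_one, Pi.smul_apply, smul_eq_mul,
      Pi.single_eq_of_ne hik.symm, mul_zero] at hi hk
    rw [Matrix.of_apply, Matrix.of_apply, hi, mul_right_comm, ← hk, zero_mul]

end

section

variable {B E D : Type u} [CommRing B] [CommRing E] [CommRing D] [Algebra B E] [Algebra B D]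
  [Algebra A D]

/-- Two homomorphisms given by two splittings of an étale algebra of rank `n` agree on symmetric
tensors. -/
theorem eq_of_splittings [Module.Finite B E] [Module.Flat B E]
    (hE : ∀ b : PrimeSpectrum B, Module.rankAtStalk (R := B) E b = n)
    (s s' : E →ₐ[B] (Fin n → D)) (hs : Submodule.span D (Set.range s) = ⊤)
    (hs' : Submodule.span D (Set.range s') = ⊤) (g : R → E) (e e' : TensorPow A R n →ₐ[A] D)
    (he : ∀ r, factorValues e r = s (g r)) (he' : ∀ r, factorValues e' r = s' (g r))
    (t : TS A R n) : e' t = e t := by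
  obtain ⟨P, hP, hrow, hcol⟩ := exists_matrix_of_span_eq_top hE s s' hs hs'
  refine eq_of_factorValues_eq_mulVec e e' P (fun i r => ?_) hrow hcol t
  exact (congrFun (he' r) i).trans ((hP i (g r)).trans
    (Finset.sum_congr rfl fun j _ => congrArg _ (congrFun (he r) j).symm))

/-- The homomorphism from a tensor power given by a homomorphism to a power. -/
def liftFactors (s : R →ₐ[A] (Fin n → D)) : TensorPow A R n →ₐ[A] D :=
  PiTensorProduct.liftAlgHom
    ((MultilinearMap.mkPiAlgebra A (Fin n) D).compLinearMap
      fun i => ((Pi.evalAlgHom A (fun _ : Fin n => D) i).comp s).toLinearMap)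
    (by simp) (fun x y => by simp [Finset.prod_mul_distrib])

theorem factorValues_liftFactors (s : R →ₐ[A] (Fin n → D)) (r : R) :
    factorValues (liftFactors s) r = s r := by
  funext i
  rw [factorValues, PiTensorProduct.singleAlgHom_apply, liftFactors,
    PiTensorProduct.liftAlgHom_apply, PiTensorProduct.lift.tprod]
  simp only [MultilinearMap.compLinearMap_apply, MultilinearMap.mkPiAlgebra_apply]
  rw [Finset.prod_eq_single i]
  · simp
  · intro j _ hj
    simp [Pi.mulSingle_eq_of_ne hj]
  · simp

end

end Splittings

/-! ### The kernel defining the pulled-back family, and uniqueness -/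

section Classification

variable {A R : Type u} [CommRing A] [CommRing R] [Algebra A R] {n : ℕ}

section Kernel

variable {B : Type u} [CommRing B] [Algebra A B]

theorem exists_extension (ν : TS A R n →ₐ[A] B) (hν : IsNondegenerate ν.toRingHom) :
    ∃ (D : Type u) (_ : CommRing D) (_ : Algebra A D) (_ : Algebra B D)
      (_ : IsScalarTower A B D) (e : TensorPow A R n →ₐ[A] D),
      Function.Injective (algebraMap B D) ∧ ∀ t : TS A R n, e t = algebraMap B D (ν t) := by
  let _ : Algebra (TS A R n) B := ν.toRingHom.toAlgebra
  have : IsScalarTower A (TS A R n) B := .of_algebraMap_eq fun a => (ν.commutes a).symm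
  refine ⟨B ⊗[TS A R n] TensorPow A R n, inferInstance, inferInstance, inferInstance,
    inferInstance, Algebra.TensorProduct.includeRight.restrictScalars A,
    algebraMap_tensorPow_injective hν, fun t => ?_⟩
  exact ((Algebra.TensorProduct.includeRight : TensorPow A R n →ₐ[TS A R n]
    B ⊗[TS A R n] TensorPow A R n).commutes t).trans
      (IsScalarTower.algebraMap_apply (TS A R n) B (B ⊗[TS A R n] TensorPow A R n) t)

section

variable {D : Type u} [CommRing D] [Algebra A D] [Algebra B D] [IsScalarTower A B D]

variable (B) in
/-- The extension of the `i`-th co-projection followed by a homomorphism to `R ⊗ B`. -/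
def tensorEval (e : TensorPow A R n →ₐ[A] D) (i : Fin n) : R ⊗[A] B →ₐ[A] D :=
  Algebra.TensorProduct.lift (e.comp (factor A i)) (IsScalarTower.toAlgHom A B D)
    (fun _ _ => Commute.all _ _)

theorem tensorEval_tmul (e : TensorPow A R n →ₐ[A] D) (i : Fin n) (r : R) (b : B) :
    tensorEval B e i (r ⊗ₜ b) = e (factor A i r) * algebraMap B D b :=
  Algebra.TensorProduct.lift_tmul ..

end

variable [Algebra (TS A R n) B] [IsScalarTower A (TS A R n) B]

variable (A R B) in
/-- The natural homomorphism from `R ⊗ B` to the base change of the family to `B`. -/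
def familyHom (p : Fin n) : R ⊗[A] B →ₐ[A] B ⊗[TS A R n] TSFix A R p :=
  Algebra.TensorProduct.lift
    ((Algebra.TensorProduct.includeRight.restrictScalars A).comp (coproj A R p))
    Algebra.TensorProduct.includeLeft (fun _ _ => Commute.all _ _)

theorem familyHom_tmul (p : Fin n) (r : R) (b : B) :
    familyHom A R B p (r ⊗ₜ b) = b ⊗ₜ coproj A R p r := by
  refine (Algebra.TensorProduct.lift_tmul ..).trans ?_
  change (1 : B) ⊗ₜ[TS A R n] coproj A R p r * b ⊗ₜ 1 = _
  rw [Algebra.TensorProduct.tmul_mul_tmul, one_mul, mul_one]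

theorem familyHom_surjective (hB : IsNondegenerate (algebraMap (TS A R n) B)) (p : Fin n) :
    Function.Surjective (familyHom A R B p) := by
  intro w
  have hw : w ∈ Submodule.span B (Set.range (coprojTensor B p)) :=
    span_coprojTensor_eq_top hB p ▸ Submodule.mem_top
  induction hw using Submodule.span_induction with
  | mem w hw =>
    obtain ⟨r, rfl⟩ := hw
    exact ⟨r ⊗ₜ 1, familyHom_tmul p r 1⟩
  | zero => exact ⟨0, map_zero _⟩
  | add v w _ _ hv hw =>
    obtain ⟨y, rfl⟩ := hv
    obtain ⟨z, rfl⟩ := hw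
    exact ⟨y + z, map_add _ _ _⟩
  | smul b v _ hv =>
    obtain ⟨y, rfl⟩ := hv
    refine ⟨1 ⊗ₜ b * y, ?_⟩
    rw [map_mul, familyHom_tmul, map_one, Algebra.smul_def]
    rfl

/-- Composing `familyHom` with the conjugations gives the evaluations `tensorEval`, and the
conjugations are jointly injective. -/
theorem familyHom_eq_zero_iff {D : Type u} [CommRing D] [Algebra A D] [Algebra B D]
    [IsScalarTower A B D] (e : TensorPow A R n →ₐ[A] D)
    (hB : IsNondegenerate (algebraMap (TS A R n) B))
    (hD : Function.Injective (algebraMap B D))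
    (he : ∀ t : TS A R n, e t = algebraMap B D (algebraMap (TS A R n) B t))
    (p : Fin n) (κ : R ⊗[A] B) :
    familyHom A R B p κ = 0 ↔ ∀ i, tensorEval B e i κ = 0 := by
  let _ : Algebra (TS A R n) D := ((algebraMap B D).comp (algebraMap (TS A R n) B)).toAlgebra
  have : IsScalarTower (TS A R n) B D := .of_algebraMap_eq fun _ => rfl
  let e' : TensorPow A R n →ₐ[TS A R n] D := { e with commutes' := he }
  have h (i : Fin n) (y : R ⊗[A] B) :
      conjTensor B e' p i (familyHom A R B p y) = tensorEval B e i y := by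
    induction y with
    | zero => simp only [map_zero]
    | add y z hy hz => simp only [map_add, hy, hz]
    | tmul r b =>
      rw [familyHom_tmul, conjTensor_tmul, conj_coproj, tensorEval_tmul, mul_comm]
      rfl
  constructor
  · intro hκ i
    rw [← h, hκ, map_zero]
  · intro hκ
    exact eq_zero_of_forall_conjTensor_eq_zero e' hB hD p fun i => by rw [h, hκ]

end Kernel

section Quotients

variable {B E : Type u} [CommRing B] [Algebra A B] [CommRing E]

/-- The kernel of `q` is the kernel of the homomorphism from `R ⊗ B` to the pull-back along `ν` of
the family, expressed in any extension of `B` to which `ν` extends as a homomorphism from the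
tensor power. -/
def DefinesFamily (ν : TS A R n →ₐ[A] B) (q : R ⊗[A] B →+* E) : Prop :=
  ∀ (D : Type u) [CommRing D] [Algebra A D] [Algebra B D] [IsScalarTower A B D]
    (e : TensorPow A R n →ₐ[A] D), Function.Injective (algebraMap B D) →
    (∀ t : TS A R n, e t = algebraMap B D (ν t)) →
    ∀ κ, q κ = 0 ↔ ∀ i, tensorEval B e i κ = 0

/-- The common kernel of the evaluations is the same in every admissible extension, and
`exists_extension` provides one. -/
theorem definesFamily_iff [Algebra (TS A R n) B] [IsScalarTower A (TS A R n) B]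
    (hB : IsNondegenerate (algebraMap (TS A R n) B)) (q : R ⊗[A] B →+* E) (p : Fin n) :
    DefinesFamily (IsScalarTower.toAlgHom A (TS A R n) B) q ↔
      ∀ κ, q κ = 0 ↔ familyHom A R B p κ = 0 := by
  constructor
  · intro h κ
    obtain ⟨D, _, _, _, _, e, hD, he⟩ :=
      exists_extension (IsScalarTower.toAlgHom A (TS A R n) B) hB
    rw [h D e hD he, familyHom_eq_zero_iff e hB hD he]
  · intro h D _ _ _ _ e hD he κ
    rw [h, familyHom_eq_zero_iff e hB hD he]

variable [Algebra B E]

theorem exists_splitting {q : R ⊗[A] B →+* E} (hq : Function.Surjective q)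
    (hqB : ∀ b : B, q (1 ⊗ₜ[A] b) = algebraMap B E b)
    {D : Type u} [CommRing D] [Algebra A D] [Algebra B D] [IsScalarTower A B D]
    (e : TensorPow A R n →ₐ[A] D) (h : ∀ κ, q κ = 0 → ∀ i, tensorEval B e i κ = 0) :
    ∃ s : E →ₐ[B] (Fin n → D), ∀ r, factorValues e r = s (q (r ⊗ₜ 1)) := by
  let S : R ⊗[A] B →+* (Fin n → D) := RingHom.pi fun i => (tensorEval B e i).toRingHom
  have hS : RingHom.ker q ≤ RingHom.ker S := fun κ hκ => funext fun i => h κ hκ i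
  let s₀ : E →+* (Fin n → D) := RingHom.liftOfSurjective q hq ⟨S, hS⟩
  have hs₀ (κ) : s₀ (q κ) = S κ := RingHom.liftOfRightInverse_comp_apply q _ _ ⟨S, hS⟩ κ
  refine ⟨{ s₀ with commutes' := fun b => ?_ }, fun r => ?_⟩
  · change s₀ (algebraMap B E b) = _
    rw [← hqB, hs₀]
    funext i
    change tensorEval B e i (1 ⊗ₜ b) = algebraMap B D b
    rw [tensorEval_tmul, map_one, map_one, one_mul]
  · change _ = s₀ (q (r ⊗ₜ 1))
    rw [hs₀]
    funext i
    change _ = tensorEval B e i (r ⊗ₜ 1)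
    rw [tensorEval_tmul, map_one, mul_one]
    rfl

theorem span_splitting {q : R ⊗[A] B →+* E} {D : Type u} [CommRing D] [Algebra A D] [Algebra B D]
    {e : TensorPow A R n →ₐ[A] D} {s : E →ₐ[B] (Fin n → D)}
    (hs : ∀ r, factorValues e r = s (q (r ⊗ₜ 1)))
    (he : Submodule.span D (Set.range (factorValues e)) = ⊤) :
    Submodule.span D (Set.range s) = ⊤ := by
  rw [eq_top_iff, ← he]
  refine Submodule.span_mono ?_
  rintro _ ⟨r, rfl⟩
  exact ⟨_, (hs r).symm⟩

theorem DefinesFamily.unique [Module.Finite B E] [Module.Flat B E]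
    (hE : ∀ b : PrimeSpectrum B, Module.rankAtStalk (R := B) E b = n)
    {q : R ⊗[A] B →+* E} (hq : Function.Surjective q)
    (hqB : ∀ b : B, q (1 ⊗ₜ[A] b) = algebraMap B E b) {ν ν' : TS A R n →ₐ[A] B}
    (hν : IsNondegenerate ν.toRingHom) (hν' : IsNondegenerate ν'.toRingHom)
    (h : DefinesFamily ν q) (h' : DefinesFamily ν' q) : ν = ν' := by
  obtain ⟨D₁, _, _, _, _, e₁, hD₁, he₁⟩ := exists_extension ν hν
  -- Extending a second time, over `D₁`, gives one ring `D` in which both `ν` and `ν'` extend to the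
  -- tensor power, so that the two splittings can be compared.
  obtain ⟨D, _, _, _, _, e', hD, he'⟩ :=
    exists_extension ((IsScalarTower.toAlgHom A B D₁).comp ν') (hν'.comp (algebraMap B D₁))
  let _ : Algebra B D := ((algebraMap D₁ D).comp (algebraMap B D₁)).toAlgebra
  have : IsScalarTower B D₁ D := .of_algebraMap_eq fun _ => rfl
  have : IsScalarTower A B D := .of_algebraMap_eq fun a => by
    rw [IsScalarTower.algebraMap_apply B D₁ D, ← IsScalarTower.algebraMap_apply A B D₁,
      ← IsScalarTower.algebraMap_apply A D₁ D]
  let e : TensorPow A R n →ₐ[A] D := (IsScalarTower.toAlgHom A D₁ D).comp e₁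
  have hinj : Function.Injective (algebraMap B D) := hD.comp hD₁
  have he (t : TS A R n) : e t = algebraMap B D (ν t) := congrArg (algebraMap D₁ D) (he₁ t)
  have he'' (t : TS A R n) : e' t = algebraMap B D (ν' t) := he' t
  obtain ⟨s, hs⟩ := exists_splitting hq hqB e fun κ => (h D e hinj he κ).1
  obtain ⟨s', hs'⟩ := exists_splitting hq hqB e' fun κ => (h' D e' hinj he'' κ).1
  have hspan : Submodule.span D (Set.range (factorValues e)) = ⊤ := by
    rw [← isNondegenerate_comp_iff]
    convert hν.comp (algebraMap B D)
    exact RingHom.ext he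
  have hspan' : Submodule.span D (Set.range (factorValues e')) = ⊤ := by
    rw [← isNondegenerate_comp_iff]
    convert hν'.comp (algebraMap B D)
    exact RingHom.ext he''
  refine AlgHom.ext fun t => hinj ?_
  rw [← he, ← he'']
  exact (eq_of_splittings hE s s' (span_splitting hs hspan) (span_splitting hs' hspan')
    (fun r => q (r ⊗ₜ 1)) e e' hs hs' t).symm

end Quotients

end Classification

/-! ### Existence by faithfully flat descent -/

section Existence

variable {A R : Type u} [CommRing A] [CommRing R] [Algebra A R] {n : ℕ}
  {B E : Type u} [CommRing B] [Algebra A B] [CommRing E] [Algebra B E]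

/-- An étale algebra of rank `n` splits over a faithfully flat extension. -/
theorem exists_faithfullyFlat_splitting [Module.Finite B E] [Algebra.Etale B E]
    (hE : ∀ b : PrimeSpectrum B, Module.rankAtStalk (R := B) E b = n) :
    ∃ (D : Type u) (_ : CommRing D) (_ : Algebra B D) (_ : Module.FaithfullyFlat B D)
      (s : E →ₐ[B] (Fin n → D)), Function.Injective s ∧
        Submodule.span D (Set.range s) = ⊤ := by
  obtain ⟨D, _, _, _, _, _, hD⟩ := Algebra.IsFiniteSplit.exists_tensorProduct_of_etale
    (R := B) (S := E) (n := n) (funext hE)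
  obtain ⟨L⟩ : Nonempty (D ⊗[B] E ≃ₐ[D] (Fin n → D)) := by
    -- The degree of a split algebra is determined only over a nonzero ring; over the zero ring any
    -- two algebras are isomorphic.
    cases subsingleton_or_nontrivial D with
    | inl h =>
      have : Subsingleton (D ⊗[B] E) := Module.subsingleton D _
      exact ⟨default⟩
    | inr h =>
      obtain ⟨m, ⟨L⟩⟩ := hD.nonempty_algEquiv_fun
      obtain ⟨P⟩ : Nonempty (PrimeSpectrum D) := inferInstance
      have h₁ := Module.rankAtStalk_baseChange (R := B) (M := E) P
      rw [hE, Module.rankAtStalk_eq_of_equiv L.toLinearEquiv,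
        Module.rankAtStalk_eq_finrank_of_free] at h₁
      have h₂ : m = n := by simpa using h₁
      exact ⟨h₂ ▸ L⟩
  let s : E →ₐ[B] (Fin n → D) :=
    (L.toAlgHom.restrictScalars B).comp Algebra.TensorProduct.includeRight
  refine ⟨D, inferInstance, inferInstance, inferInstance, s, ?_, ?_⟩
  · exact L.injective.comp (Module.FaithfullyFlat.tensorProduct_mk_injective E)
  · refine Submodule.eq_top_iff'.2 fun v => ?_
    obtain ⟨y, rfl⟩ := L.surjective v
    induction y with
    | zero => rw [map_zero]; exact Submodule.zero_mem _
    | add y z hy hz => rw [map_add]; exact Submodule.add_mem _ hy hz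
    | tmul d z =>
      have h : d ⊗ₜ[B] z = d • ((1 : D) ⊗ₜ[B] z) := by
        rw [TensorProduct.smul_tmul', smul_eq_mul, mul_one]
      rw [h, map_smul]
      exact Submodule.smul_mem _ _ (Submodule.subset_span ⟨z, rfl⟩)

theorem span_factorValues_eq_top {q : R ⊗[A] B →+* E} (hq : Function.Surjective q)
    (hqB : ∀ b : B, q (1 ⊗ₜ[A] b) = algebraMap B E b)
    {D : Type u} [CommRing D] [Algebra A D] [Algebra B D]
    {e : TensorPow A R n →ₐ[A] D} {s : E →ₐ[B] (Fin n → D)}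
    (hs : ∀ r, factorValues e r = s (q (r ⊗ₜ 1)))
    (hspan : Submodule.span D (Set.range s) = ⊤) :
    Submodule.span D (Set.range (factorValues e)) = ⊤ := by
  rw [eq_top_iff, ← hspan, Submodule.span_le]
  rintro _ ⟨z, rfl⟩
  obtain ⟨y, rfl⟩ := hq z
  induction y with
  | zero => rw [map_zero, map_zero]; exact Submodule.zero_mem _
  | add y z hy hz => rw [map_add, map_add]; exact Submodule.add_mem _ hy hz
  | tmul r b =>
    have h : s (q (r ⊗ₜ b)) = algebraMap B D b • s (q (r ⊗ₜ 1)) := by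
      have : r ⊗ₜ[A] b = 1 ⊗ₜ b * r ⊗ₜ 1 := by
        rw [Algebra.TensorProduct.tmul_mul_tmul, one_mul, mul_one]
      rw [this, map_mul, map_mul, hqB, s.commutes, Algebra.smul_def]
      rfl
    rw [h, ← hs]
    exact Submodule.smul_mem _ _ (Submodule.subset_span ⟨r, rfl⟩)

theorem exists_definesFamily [Module.Finite B E] [Algebra.Etale B E]
    (hE : ∀ b : PrimeSpectrum B, Module.rankAtStalk (R := B) E b = n)
    {q : R ⊗[A] B →+* E} (hq : Function.Surjective q)
    (hqB : ∀ b : B, q (1 ⊗ₜ[A] b) = algebraMap B E b) (p : Fin n) :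
    ∃ ν : TS A R n →ₐ[A] B, IsNondegenerate ν.toRingHom ∧ DefinesFamily ν q := by
  have : Module.Flat B E := inferInstance
  obtain ⟨D, _, _, _, s, hsinj, hspan⟩ := exists_faithfullyFlat_splitting hE
  let _ : Algebra A D := ((algebraMap B D).comp (algebraMap A B)).toAlgebra
  have : IsScalarTower A B D := .of_algebraMap_eq fun _ => rfl
  have hD : Function.Injective (algebraMap B D) := FaithfulSMul.algebraMap_injective B D
  let sR : R →ₐ[A] (Fin n → D) :=
    { toRingHom := s.toRingHom.comp
        (q.comp (Algebra.TensorProduct.includeLeft : R →ₐ[A] R ⊗[A] B).toRingHom)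
      commutes' := fun a => by
        change s (q ((Algebra.TensorProduct.includeLeft : R →ₐ[A] R ⊗[A] B)
          (algebraMap A R a))) = _
        rw [AlgHom.commutes, Algebra.TensorProduct.algebraMap_apply',
          hqB, s.commutes, ← IsScalarTower.algebraMap_apply] }
  let e : TensorPow A R n →ₐ[A] D := liftFactors sR
  have he (r : R) : factorValues e r = s (q (r ⊗ₜ 1)) := factorValues_liftFactors sR r
  have hnd : IsNondegenerate (e.toRingHom.comp (algebraMap (TS A R n) (TensorPow A R n))) :=
    (isNondegenerate_comp_iff e).2 (span_factorValues_eq_top hq hqB he hspan)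
  -- The two maps to `D ⊗ D` turn `s` into two splittings of the same `E`, so the two images of `e
  -- t` agree and `e t` descends to `B`.
  have hdesc (t : TS A R n) : e t ∈ (IsScalarTower.toAlgHom A B D).range := by
    let i₁ : D →ₐ[B] D ⊗[B] D := Algebra.TensorProduct.includeLeft
    let i₂ : D →ₐ[B] D ⊗[B] D := Algebra.TensorProduct.includeRight
    have hi (i : D →ₐ[B] D ⊗[B] D) :
        (∀ r, factorValues ((i.restrictScalars A).comp e) r = i.compLeft (Fin n) (s (q (r ⊗ₜ 1)))) ∧
        Submodule.span (D ⊗[B] D) (Set.range ((i.compLeft (Fin n)).comp s)) = ⊤ := by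
      have h₁ (r : R) : factorValues ((i.restrictScalars A).comp e) r =
          i.compLeft (Fin n) (s (q (r ⊗ₜ 1))) :=
        congrArg (i.compLeft (Fin n)) (he r)
      exact ⟨h₁, span_splitting (s := (i.compLeft (Fin n)).comp s) h₁
        ((isNondegenerate_comp_iff _).1 (hnd.comp i.toRingHom))⟩
    have h := eq_of_splittings hE _ _ (hi i₁).2 (hi i₂).2 (fun r => q (r ⊗ₜ 1)) _ _
      (hi i₁).1 (hi i₂).1 t
    have hmem : e t ∈ Set.range (algebraMap B D) := by
      rw [← (Algebra.IsEffective.of_faithfullyFlat B D).eqLocus_includeLeft_includeRight]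
      exact h.symm
    exact hmem
  let ν : TS A R n →ₐ[A] B :=
    (AlgEquiv.ofInjective (IsScalarTower.toAlgHom A B D) hD).symm.toAlgHom.comp
      ((e.comp (TS A R n).val).codRestrict _ hdesc)
  have hν (t : TS A R n) : e t = algebraMap B D (ν t) :=
    (congrArg Subtype.val ((AlgEquiv.ofInjective (IsScalarTower.toAlgHom A B D) hD).apply_symm_apply
      ⟨e t, hdesc t⟩)).symm
  have hνnd : IsNondegenerate ν.toRingHom := by
    -- An ideal of `B` whose extension to the faithfully flat `D` is the unit ideal is itself the
    -- unit ideal.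
    refine Ideal.map_injective_of_faithfullyFlat (A := B) (B := D) ?_
    have : (algebraMap B D).comp ν.toRingHom =
        e.toRingHom.comp (algebraMap (TS A R n) (TensorPow A R n)) :=
      RingHom.ext fun t => (hν t).symm
    rw [Ideal.map_span, Ideal.map_top, ← Set.range_comp]
    rw [← this] at hnd
    exact hnd
  refine ⟨ν, hνnd, ?_⟩
  let _ : Algebra (TS A R n) B := ν.toRingHom.toAlgebra
  have : IsScalarTower A (TS A R n) B := .of_algebraMap_eq fun a => (ν.commutes a).symm
  refine (definesFamily_iff hνnd q p).2 fun κ => ?_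
  rw [familyHom_eq_zero_iff e hνnd hD hν, ← map_eq_zero_iff s hsinj, funext_iff]
  refine forall_congr' fun i => ?_
  suffices h : s (q κ) i = tensorEval B e i κ by rw [h]; rfl
  induction κ with
  | zero => simp only [map_zero, Pi.zero_apply]
  | add y z hy hz => simp only [map_add, Pi.add_apply, hy, hz]
  | tmul r b =>
    have h : r ⊗ₜ[A] b = r ⊗ₜ 1 * 1 ⊗ₜ b := by
      rw [Algebra.TensorProduct.tmul_mul_tmul, one_mul, mul_one]
    rw [tensorEval_tmul, h, map_mul, map_mul, hqB, s.commutes, Pi.mul_apply, ← he]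
    rfl

end Existence

/-! ### The family over `𝒰_R` and the closed immersion -/

section Geometry

variable {A R : Type u} [CommRing A] [CommRing R] [Algebra A R] {n : ℕ}

theorem mem_U_iff (y : Spec (.of (TS A R n))) :
    y ∈ U A R n ↔ ∃ x : Fin n → R, y ∈ PrimeSpectrum.basicOpen (alternatingSq A x) := by
  rw [U_eq]
  exact TopologicalSpace.Opens.mem_iSup

/-- This makes `family` a base change of `psi`, so its pull-backs to affine schemes are spectra of
tensor products. -/
theorem Z_eq_preimage (p : Fin n) : Z A R p = psi A R p ⁻¹ᵁ U A R n := by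
  refine le_antisymm (Z_le_preimage A R p) fun z hz => ?_
  rw [Z_eq]
  exact TopologicalSpace.Opens.mem_iSup.2 ((mem_U_iff _).1 hz)

section

variable {B : Type u} [CommRing B] {φ : TS A R n →+* B}

theorem isNondegenerate_of_comp_ι_eq (f : Spec (.of B) ⟶ (U A R n).toScheme)
    (hf : f ≫ (U A R n).ι = Spec.map (CommRingCat.ofHom φ)) : IsNondegenerate φ := by
  by_contra hne
  obtain ⟨m, hm, hle⟩ := Ideal.exists_le_maximal _ hne
  let y : Spec (.of B) := ⟨m, hm.isPrime⟩
  have hy : (Spec.map (CommRingCat.ofHom φ)) y ∈ U A R n := by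
    rw [← hf]
    exact (f y).2
  obtain ⟨x, hx⟩ := (mem_U_iff _).1 hy
  exact hx (hle (Ideal.subset_span ⟨x, rfl⟩))

theorem IsNondegenerate.exists_comp_ι_eq (hφ : IsNondegenerate φ) :
    ∃ f : Spec (.of B) ⟶ (U A R n).toScheme,
      f ≫ (U A R n).ι = Spec.map (CommRingCat.ofHom φ) := by
  refine ⟨IsOpenImmersion.lift (U A R n).ι (Spec.map (CommRingCat.ofHom φ)) ?_,
    IsOpenImmersion.lift_fac _ _ _⟩
  rw [Scheme.Opens.range_ι]
  rintro _ ⟨y, rfl⟩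
  by_contra hy
  have h (x : Fin n → R) : φ (alternatingSq A x) ∈ y.asIdeal := by
    by_contra hx
    exact hy ((mem_U_iff _).2 ⟨x, hx⟩)
  refine y.isPrime.ne_top (eq_top_iff.2 (hφ ▸ Ideal.span_le.2 ?_))
  rintro _ ⟨x, rfl⟩
  exact h x

end

theorem isPullback_family_ι (p : Fin n) :
    IsPullback (Z A R p).ι (family A R p) (psi A R p) (U A R n).ι := by
  -- The open set is made a variable so that the equality with the preimage can be substituted in
  -- the types.
  have key : ∀ (V : (Spec (.of (TSFix A R p))).Opens) (hV : V ≤ psi A R p ⁻¹ᵁ U A R n),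
      V = psi A R p ⁻¹ᵁ U A R n →
      IsPullback V.ι ((psi A R p).resLE (U A R n) V hV) (psi A R p) (U A R n).ι := by
    rintro V hV rfl
    rw [Scheme.Hom.resLE_eq_morphismRestrict]
    exact (isPullback_morphismRestrict _ _).flip
  exact key _ _ (Z_eq_preimage p)

theorem exists_isPullback_family {B : Type u} [CommRing B] [Algebra (TS A R n) B] (p : Fin n)
    (f : Spec (.of B) ⟶ (U A R n).toScheme)
    (hf : f ≫ (U A R n).ι = Spec.map (CommRingCat.ofHom (algebraMap (TS A R n) B))) :
    ∃ g : Spec (.of (B ⊗[TS A R n] TSFix A R p)) ⟶ (Z A R p).toScheme,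
      g ≫ (Z A R p).ι = Spec.map (CommRingCat.ofHom
        (Algebra.TensorProduct.includeRight :
          TSFix A R p →ₐ[TS A R n] B ⊗[TS A R n] TSFix A R p).toRingHom) ∧
      IsPullback g (Spec.map (CommRingCat.ofHom (algebraMap B (B ⊗[TS A R n] TSFix A R p))))
        (family A R p) f := by
  have h₁ := isPullback_SpecMap_of_isPushout _ _ _ _
    (CommRingCat.isPushout_tensorProduct (TS A R n) B (TSFix A R p)).flip
  have h₂ := isPullback_family_ι (A := A) (R := R) p
  let g := h₂.lift (Spec.map (CommRingCat.ofHom (Algebra.TensorProduct.includeRight :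
          TSFix A R p →ₐ[TS A R n] B ⊗[TS A R n] TSFix A R p).toRingHom))
    (Spec.map (CommRingCat.ofHom (algebraMap B (B ⊗[TS A R n] TSFix A R p))) ≫ f)
    (by rw [Category.assoc, hf]; exact h₁.w)
  refine ⟨g, h₂.lift_fst _ _ _, ?_⟩
  refine IsPullback.of_right ?_ (h₂.lift_snd _ _ _) h₂
  rw [hf, h₂.lift_fst]
  exact h₁

section

variable {C : Type u} [CommRing C] [Algebra (TS A R n) C] (p : Fin n) (x : Fin n → R)

theorem isFinite_SpecMap_of_isUnit
    (hx : IsUnit (algebraMap (TS A R n) C (alternatingSq A x))) :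
    IsFinite (Spec.map (CommRingCat.ofHom (algebraMap C (C ⊗[TS A R n] TSFix A R p)))) :=
  (IsFinite.SpecMap_iff _).2 (RingHom.finite_algebraMap.2 (.of_basis (coprojBasis p x hx)))

theorem etale_SpecMap_of_isUnit
    (hx : IsUnit (algebraMap (TS A R n) C (alternatingSq A x))) :
    Etale (Spec.map (CommRingCat.ofHom (algebraMap C (C ⊗[TS A R n] TSFix A R p)))) :=
  (HasRingHomProperty.Spec_iff (P := @Etale)).2
    (RingHom.etale_algebraMap.2 (etale_of_isUnit p x hx))

theorem finrank_SpecMap_of_isUnit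
    (hx : IsUnit (algebraMap (TS A R n) C (alternatingSq A x)))
    (w : PrimeSpectrum C) :
    Scheme.Hom.finrank
      (Spec.map (CommRingCat.ofHom (algebraMap C (C ⊗[TS A R n] TSFix A R p)))) w = n := by
  have : Module.Free C (C ⊗[TS A R n] TSFix A R p) := .of_basis (coprojBasis p x hx)
  have : Module.Finite C (C ⊗[TS A R n] TSFix A R p) := .of_basis (coprojBasis p x hx)
  have : Module.Flat C (C ⊗[TS A R n] TSFix A R p) := Module.Flat.of_free
  have : Nontrivial C := PrimeSpectrum.nontrivial w
  rw [Scheme.Hom.finrank_SpecMap_algebraMap, Module.rankAtStalk_eq_finrank_of_free,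
    Pi.natCast_apply, Module.finrank_eq_card_basis (coprojBasis p x hx)]
  simp

end

theorem isZariskiLocalAtTarget_isFinite : IsZariskiLocalAtTarget.{u} @IsFinite :=
  have : HasAffineProperty @IsFinite (affineAnd RingHom.Finite) :=
    (HasAffineProperty.affineAnd_iff _ RingHom.finite_respectsIso
      RingHom.finite_localizationPreserves.away RingHom.finite_ofLocalizationSpan).2
      fun f => isFinite_iff f
  HasAffineProperty.instIsZariskiLocalAtTarget (Q := affineAnd RingHom.Finite)

theorem family_isEtaleOfRank (p : Fin n) : IsEtaleOfRank n (family A R p) := by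
  have hloc (x : Fin n → R) : IsUnit (algebraMap (TS A R n)
      (Localization.Away (alternatingSq A x)) (alternatingSq A x)) :=
    IsLocalization.Away.algebraMap_isUnit _
  have hlift (x : Fin n → R) := (isNondegenerate_of_isUnit x (hloc x)).exists_comp_ι_eq
  choose f hf using hlift
  have hopen (x) : IsOpenImmersion (f x) := by
    have : IsOpenImmersion (Spec.map (CommRingCat.ofHom
        (algebraMap (TS A R n) (Localization.Away (alternatingSq A x))))) :=
      inferInstance
    have : IsOpenImmersion (f x ≫ (U A R n).ι) := by rw [hf]; infer_instance
    exact IsOpenImmersion.of_comp _ (U A R n).ι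
  have hcover (y : (U A R n).toScheme) : ∃ x, y ∈ Set.range (f x) := by
    obtain ⟨x, hx⟩ := (mem_U_iff _).1 y.2
    have hy : y.1 ∈ Set.range (Spec.map (CommRingCat.ofHom
        (algebraMap (TS A R n) (Localization.Away (alternatingSq A x))))) := by
      have := PrimeSpectrum.localization_away_comap_range
        (Localization.Away (alternatingSq A x)) (alternatingSq A x)
      exact this.symm ▸ hx
    obtain ⟨w, hw⟩ := hy
    refine ⟨x, w, (U A R n).ι.isOpenEmbedding.injective ?_⟩
    rw [← Scheme.Hom.comp_apply, hf]
    exact hw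
  let 𝒞 : (U A R n).toScheme.OpenCover :=
    Scheme.Cover.mkOfCovers (Fin n → R) (fun x => Spec (.of (Localization.Away (alternatingSq A x))))
      f (fun y => hcover y) hopen
  have hpb (x) := exists_isPullback_family p (f x) (hf x)
  choose g _ hg using hpb
  have hsnd (x) : pullback.snd (family A R p) (f x) = (hg x).isoPullback.inv ≫
      Spec.map (CommRingCat.ofHom (algebraMap (Localization.Away (alternatingSq A x))
        (Localization.Away (alternatingSq A x) ⊗[TS A R n] TSFix A R p))) :=
    ((hg x).isoPullback_inv_snd).symm
  have hfin (x) : IsFinite (pullback.snd (family A R p) (f x)) := by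
    rw [hsnd]
    have := isFinite_SpecMap_of_isUnit p x (hloc x)
    infer_instance
  have het (x) : Etale (pullback.snd (family A R p) (f x)) := by
    rw [hsnd]
    have := etale_SpecMap_of_isUnit p x (hloc x)
    infer_instance
  have hfinite : IsFinite (family A R p) :=
    @IsZariskiLocalAtTarget.of_openCover @IsFinite isZariskiLocalAtTarget_isFinite _ _ _ 𝒞 hfin
  have hetale : Etale (family A R p) :=
    @IsZariskiLocalAtTarget.of_openCover @Etale
      (HasRingHomProperty.instIsZariskiLocalAtTarget (P := @Etale) (Q := RingHom.Etale)) _ _ _ 𝒞 het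
  refine ⟨hfinite, hetale, fun y => ?_⟩
  obtain ⟨x, w, rfl⟩ := hcover y
  rw [← Scheme.Hom.finrank_of_isPullback _ _ _ _ (hg x) w]
  exact finrank_SpecMap_of_isUnit p x (hloc x) w

/-- A morphism to `𝒵_R` is determined by its components in `Spec R` and in `𝒰_R`. -/
theorem eq_of_comp_ZToX_eq {p : Fin n} {C : CommRingCat.{u}} (g h : Spec C ⟶ (Z A R p).toScheme)
    (hR : g ≫ ZToX A R p = h ≫ ZToX A R p) (hU : g ≫ family A R p = h ≫ family A R p) :
    g = h := by
  rw [← cancel_mono (Z A R p).ι]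
  obtain ⟨γ, hγ⟩ := Spec.map_surjective (g ≫ (Z A R p).ι)
  obtain ⟨η, hη⟩ := Spec.map_surjective (h ≫ (Z A R p).ι)
  have hTS : CommRingCat.ofHom (inclTS A R p).toRingHom ≫ γ =
      CommRingCat.ofHom (inclTS A R p).toRingHom ≫ η := by
    apply Spec.map_injective
    have := congrArg (· ≫ (U A R n).ι) hU
    simp only [Category.assoc, family, Scheme.Hom.resLE_comp_ι, psi] at this
    rwa [Spec.map_comp, Spec.map_comp, hγ, hη, Category.assoc, Category.assoc]
  have hco : CommRingCat.ofHom (coproj A R p).toRingHom ≫ γ =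
      CommRingCat.ofHom (coproj A R p).toRingHom ≫ η := by
    apply Spec.map_injective
    rwa [Spec.map_comp, Spec.map_comp, hγ, hη, Category.assoc, Category.assoc]
  have hnd : IsNondegenerate (γ.hom.comp (inclTS A R p).toRingHom) := by
    refine isNondegenerate_of_comp_ι_eq (B := C) (g ≫ family A R p) ?_
    rw [Category.assoc, family, Scheme.Hom.resLE_comp_ι, ← Category.assoc, ← hγ, psi,
      ← Spec.map_comp]
    rfl
  have hTS' (t : TS A R n) : γ.hom (inclTS A R p t) = η.hom (inclTS A R p t) :=
    congrArg (fun k => k.hom t) hTS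
  have hco' (r : R) : γ.hom (coproj A R p r) = η.hom (coproj A R p r) :=
    congrArg (fun k => k.hom r) hco
  rw [← hγ, ← hη]
  congr 1
  ext z
  refine sub_eq_zero.1 (eq_zero_of_forall_smul_eq_zero hnd fun x => ?_)
  -- `γ` and `η` agree on symmetric tensors and on co-projections, hence on `α²(x) z` by Cramer's
  -- rule; the images of the `α²(x)` generate the unit ideal.
  obtain ⟨c, hc⟩ := exists_expansion p x z
  have h₁ := congrArg γ.hom hc
  have h₂ := congrArg η.hom hc
  simp only [map_sum, map_mul, ← hTS', ← hco'] at h₁ h₂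
  rw [smul_eq_mul, mul_sub]
  exact sub_eq_zero.2 (h₁.trans h₂.symm)

/-- A finite monomorphism is a closed immersion. Finiteness is inherited from `family`, the
composite with the second projection, and monicity is tested on affine schemes. -/
theorem ZToProd_isClosedImmersion (p : Fin n) : IsClosedImmersion (ZToProd A R p) := by
  rw [IsClosedImmersion.iff_isFinite_and_mono]
  constructor
  · have h₁ : ZToProd A R p ≫ pullback.snd _ _ = family A R p := pullback.lift_snd _ _ _
    have := (family_isEtaleOfRank (A := A) (R := R) p).isFinite
    have : IsFinite (ZToProd A R p ≫ pullback.snd (Spec.map (CommRingCat.ofHom (algebraMap A R)))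
        (UToBase A R (n := n))) := by rwa [h₁]
    exact IsFinite.of_comp (ZToProd A R p) (pullback.snd _ _)
  · refine ⟨fun {S} g h hgh => ?_⟩
    refine Scheme.Cover.hom_ext S.affineCover _ _ fun i => ?_
    have hgh' : (S.affineCover.f i ≫ g) ≫ ZToProd A R p =
        (S.affineCover.f i ≫ h) ≫ ZToProd A R p := by
      rw [Category.assoc, Category.assoc, hgh]
    generalize S.affineCover.f i ≫ g = g', S.affineCover.f i ≫ h = h' at hgh'
    have hR : g' ≫ ZToX A R p = h' ≫ ZToX A R p := by
      have := congrArg (· ≫ pullback.fst _ _) hgh'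
      simpa only [Category.assoc, ZToProd, pullback.lift_fst] using this
    have hU : g' ≫ family A R p = h' ≫ family A R p := by
      have := congrArg (· ≫ pullback.snd _ _) hgh'
      simpa only [Category.assoc, ZToProd, pullback.lift_snd] using this
    exact eq_of_comp_ZToX_eq g' h' hR hU

end Geometry

/-! ### From kernels of ring homomorphisms to closed subschemes -/

section UniversalProperty

variable {A R : Type u} [CommRing A] [CommRing R] [Algebra A R] {n : ℕ}
  {B : Type u} [CommRing B] [Algebra A B]

theorem exists_iso_pulledBack [Algebra (TS A R n) B] [IsScalarTower A (TS A R n) B] (p : Fin n)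
    (f : Spec (.of B) ⟶ (U A R n).toScheme)
    (hf : f ≫ UToBase A R = Spec.map (CommRingCat.ofHom (algebraMap A B)))
    (hfB : f ≫ (U A R n).ι = Spec.map (CommRingCat.ofHom (algebraMap (TS A R n) B))) :
    ∃ e : Spec (.of (B ⊗[TS A R n] TSFix A R p)) ≅ pullback (family A R p) f,
      e.hom ≫ pulledBack A R p f hf =
        Spec.map (CommRingCat.ofHom (familyHom A R B p).toRingHom) := by
  obtain ⟨g, hgι, hg⟩ := exists_isPullback_family p f hfB
  refine ⟨hg.isoPullback, ?_⟩
  rw [pulledBack, ← Category.assoc, ← Iso.eq_comp_inv]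
  apply pullback.hom_ext
  · rw [Category.assoc, Category.assoc, pullback.lift_fst, pullbackSpecIso_inv_fst,
      hg.isoPullback_hom_fst_assoc, ZToX, ← Category.assoc, hgι, ← Spec.map_comp, ← Spec.map_comp]
    congr 1
    ext r
    exact (familyHom_tmul p r 1).symm
  · rw [Category.assoc, Category.assoc, pullback.lift_snd, pullbackSpecIso_inv_snd,
      hg.isoPullback_hom_snd, ← Spec.map_comp]
    congr 1
    ext b
    exact ((familyHom_tmul p 1 b).trans (by rw [map_one]; rfl)).symm

theorem exists_ringEquiv_of_ker_eq {S E W : Type*} [CommRing S] [CommRing E] [CommRing W]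
    {q : S →+* E} {ρ : S →+* W} (hq : Function.Surjective q) (hρ : Function.Surjective ρ)
    (h : ∀ κ, q κ = 0 ↔ ρ κ = 0) : ∃ ε : W ≃+* E, ∀ κ, ε (ρ κ) = q κ := by
  have hker : RingHom.ker ρ = RingHom.ker q := Ideal.ext fun κ => (h κ).symm
  refine ⟨(RingHom.quotientKerEquivOfSurjective hρ).symm.trans
    ((Ideal.quotEquivOfEq hker).trans (RingHom.quotientKerEquivOfSurjective hq)), fun κ => ?_⟩
  have h₁ : (RingHom.quotientKerEquivOfSurjective hρ).symm (ρ κ) = Ideal.Quotient.mk _ κ :=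
    (RingEquiv.symm_apply_eq _).2 rfl
  rw [RingEquiv.trans_apply, RingEquiv.trans_apply, h₁]
  rfl

/-- Both subschemes are spectra of quotients of `R ⊗ B`, and closed subschemes of an affine scheme
coincide exactly when the kernels do. -/
theorem eqAsClosedSubschemes_pulledBack_iff {E : Type u} [CommRing E] {q : R ⊗[A] B →+* E}
    (hq : Function.Surjective q) (p : Fin n) (f : Spec (.of B) ⟶ (U A R n).toScheme)
    (hf : f ≫ UToBase A R = Spec.map (CommRingCat.ofHom (algebraMap A B)))
    (ν : TS A R n →ₐ[A] B) (hfν : f ≫ (U A R n).ι = Spec.map (CommRingCat.ofHom ν.toRingHom)) :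
    EqAsClosedSubschemes (Spec.map (CommRingCat.ofHom q)) (pulledBack A R p f hf) ↔
      DefinesFamily ν q := by
  let _ : Algebra (TS A R n) B := ν.toRingHom.toAlgebra
  have : IsScalarTower A (TS A R n) B := .of_algebraMap_eq fun a => (ν.commutes a).symm
  have hν : IsNondegenerate (algebraMap (TS A R n) B) := isNondegenerate_of_comp_ι_eq f hfν
  obtain ⟨e, he⟩ := exists_iso_pulledBack p f hf hfν
  have hρ := familyHom_surjective hν p
  refine Iff.trans ?_ (definesFamily_iff hν q p).symm
  constructor
  · rintro ⟨-, -, ε, hε⟩ κ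
    obtain ⟨τ, hτ⟩ := Spec.map_surjective (ε.hom ≫ e.inv)
    obtain ⟨υ, hυ⟩ := Spec.map_surjective (e.hom ≫ ε.inv)
    have h₁ : CommRingCat.ofHom (familyHom A R B p).toRingHom ≫ τ = CommRingCat.ofHom q := by
      apply Spec.map_injective
      rw [Spec.map_comp, hτ, ← he, Category.assoc, Iso.inv_hom_id_assoc, hε]
    have h₂ : CommRingCat.ofHom q ≫ υ = CommRingCat.ofHom (familyHom A R B p).toRingHom := by
      apply Spec.map_injective
      rw [Spec.map_comp, hυ, ← hε, Category.assoc, Iso.inv_hom_id_assoc, he]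
    have h₁' : τ.hom (familyHom A R B p κ) = q κ := congrArg (fun k => k.hom κ) h₁
    have h₂' : υ.hom (q κ) = familyHom A R B p κ := congrArg (fun k => k.hom κ) h₂
    constructor
    · intro h
      rw [← h₂', h, map_zero]
    · intro h
      rw [← h₁', h, map_zero]
  · intro h
    obtain ⟨ε, hε⟩ := exists_ringEquiv_of_ker_eq (ρ := (familyHom A R B p).toRingHom) hq hρ h
    have h₁ : IsClosedImmersion (Spec.map (CommRingCat.ofHom q)) :=
      IsClosedImmersion.spec_of_surjective _ hq
    have h₂ : IsClosedImmersion (Spec.map (CommRingCat.ofHom (familyHom A R B p).toRingHom)) :=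
      IsClosedImmersion.spec_of_surjective _ hρ
    have h₃ : pulledBack A R p f hf =
        e.inv ≫ Spec.map (CommRingCat.ofHom (familyHom A R B p).toRingHom) := by
      rw [← he, Iso.inv_hom_id_assoc]
    have h₄ : IsClosedImmersion (pulledBack A R p f hf) := by
      rw [h₃]
      infer_instance
    refine ⟨h₁, h₄, Scheme.Spec.mapIso ε.toCommRingCatIso.op ≪≫ e, ?_⟩
    rw [Iso.trans_hom, Category.assoc, he]
    change Spec.map ε.toCommRingCatIso.hom ≫ _ = _
    rw [← Spec.map_comp]
    congr 1
    exact CommRingCat.hom_ext (RingHom.ext hε)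

theorem exists_algHom_of_comp_UToBase (f : Spec (.of B) ⟶ (U A R n).toScheme)
    (hf : f ≫ UToBase A R = Spec.map (CommRingCat.ofHom (algebraMap A B))) :
    ∃ ν : TS A R n →ₐ[A] B, f ≫ (U A R n).ι = Spec.map (CommRingCat.ofHom ν.toRingHom) := by
  obtain ⟨φ, hφ⟩ := Spec.map_surjective (f ≫ (U A R n).ι)
  have h : CommRingCat.ofHom (algebraMap A (TS A R n)) ≫ φ =
      CommRingCat.ofHom (algebraMap A B) := by
    apply Spec.map_injective
    rw [Spec.map_comp, hφ, Category.assoc]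
    exact hf
  exact ⟨{ φ.hom with commutes' := fun a => congrArg (fun k => k.hom a) h }, hφ.symm⟩

theorem comp_UToBase_of_comp_ι_eq (f : Spec (.of B) ⟶ (U A R n).toScheme) (ν : TS A R n →ₐ[A] B)
    (hf : f ≫ (U A R n).ι = Spec.map (CommRingCat.ofHom ν.toRingHom)) :
    f ≫ UToBase A R = Spec.map (CommRingCat.ofHom (algebraMap A B)) := by
  rw [UToBase, ← Category.assoc, hf, ← Spec.map_comp]
  congr 1
  ext a
  exact ν.commutes a

theorem existsUnique_eqAsClosedSubschemes {E : Type u} [CommRing E] [Algebra B E]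
    [Module.Finite B E] [Algebra.Etale B E]
    (hE : ∀ b : PrimeSpectrum B, Module.rankAtStalk (R := B) E b = n)
    {q : R ⊗[A] B →+* E} (hq : Function.Surjective q)
    (hqB : ∀ b : B, q (1 ⊗ₜ[A] b) = algebraMap B E b) (p : Fin n) :
    ∃! f : Spec (.of B) ⟶ (U A R n).toScheme,
      ∃ hf : f ≫ UToBase A R = Spec.map (CommRingCat.ofHom (algebraMap A B)),
        EqAsClosedSubschemes (Spec.map (CommRingCat.ofHom q)) (pulledBack A R p f hf) := by
  have : Module.Flat B E := inferInstance
  obtain ⟨ν, hν, hνq⟩ := exists_definesFamily hE hq hqB p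
  obtain ⟨f, hf⟩ := hν.exists_comp_ι_eq
  have hfA := comp_UToBase_of_comp_ι_eq f ν hf
  refine ⟨f, ⟨hfA, (eqAsClosedSubschemes_pulledBack_iff hq p f hfA ν hf).2 hνq⟩, ?_⟩
  rintro f' ⟨hfA', h'⟩
  obtain ⟨ν', hf'⟩ := exists_algHom_of_comp_UToBase f' hfA'
  have hνq' := (eqAsClosedSubschemes_pulledBack_iff hq p f' hfA' ν' hf').1 h'
  have hνν' := DefinesFamily.unique hE hq hqB hν (isNondegenerate_of_comp_ι_eq f' hf') hνq hνq'
  rw [← cancel_mono (U A R n).ι, hf, hf', hνν']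

end UniversalProperty

end

end EtaleFamilies

theorem mainTheorem4 (A R : Type u) [CommRing A] [CommRing R] [Algebra A R]
    (n : ℕ) (hn : 1 ≤ n) :
    EtaleFamilies.IsEtaleOfRank n
        (EtaleFamilies.family A R (EtaleFamilies.lastFactor hn)) ∧
    IsClosedImmersion (EtaleFamilies.ZToProd A R (EtaleFamilies.lastFactor hn)) ∧
    ∀ (B : Type u) [CommRing B] [Algebra A B]
      (E : Type u) [CommRing E] [Algebra B E]
      (q : R ⊗[A] B →+* E),
      Function.Surjective q →
      (∀ b : B, q (1 ⊗ₜ[A] b) = algebraMap B E b) →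
      Module.Finite B E → Algebra.Etale B E →
      (∀ b : PrimeSpectrum B, Module.rankAtStalk (R := B) E b = n) →
      ∃! f : Spec (.of B) ⟶ (EtaleFamilies.U A R n).toScheme,
        ∃ hf : f ≫ EtaleFamilies.UToBase A R =
            Spec.map (CommRingCat.ofHom (algebraMap A B)),
          EtaleFamilies.EqAsClosedSubschemes (Spec.map (CommRingCat.ofHom q))
            (EtaleFamilies.pulledBack A R (EtaleFamilies.lastFactor hn) f hf) :=
  ⟨EtaleFamilies.family_isEtaleOfRank _, EtaleFamilies.ZToProd_isClosedImmersion _,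
    fun _ _ _ _ _ _ _ hq hqB _ _ hE =>
      EtaleFamilies.existsUnique_eqAsClosedSubschemes hE hq hqB _⟩
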